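/- **Setting.** Let $n\ge 1$. *Link patterns.* Let $LP(n)$ be the set of link patterns, i.e. non-crossing perfect matchings $\pi$ of $2n$ points on the boundary of a disk, labelled cyclically $1,\dots,2n$ (indices are read modulo $2n$, so the label $0$ is the label $2n$), and let $\pi(i)$ be the point matched to $i$. Let $R$ be the rotation, which replaces every pair $(i,k)$ of $\pi$ by $(i-1,k-1)$. For each $j$ modulo $2n$, let $e_j\pi=\pi$ if $\pi(j)=j+1$, and otherwise let $e_j\pi$ be obtained from $\pi$ by replacing the pairs $(j,\pi(j)),(j+1,\pi(j+1))$ with $(j,j+1),(\pi(j),\pi(j+1))$. Both $R$ and $e_j$ act linearly on $\mathbb{C}^{LP(n)}$, with canonical basis $|\pi\rangle$, by $R|\pi\rangle=|R\pi\rangle$ and $e_j|\pi\rangle=|e_j\pi\rangle$. *Fully-packed loops.* Consider the $n\times n$ square of vertices of the square lattice, with its internal edges and its $4n$ boundary edges. The boundary edges are numbered $1,\dots,4n$ counter-clockwise, starting from the vertical edge below the bottom-left vertex. Let $Fpl(n,+)$ be the set of colourings of all edges in black and white such that every vertex is adjacent to exactly two black and two white edges, and such that the $i$-th boundary edge is black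 for $i$ odd and white for $i$ even. Label the black boundary edge number $2j-1$ by $j$, $1\le j\le 2n$. The link pattern $\pi(\phi)\in LP(n)$ of $\phi\in Fpl(n,+)$ matches two labels if the two black boundary edges are joined by a black path of $\phi$. *Vertex types.* At a vertex, $\phi$ has type $a$ if the left and bottom edges have one colour and the right and top edges the other; type $b$ if the left and top edges have one colour and the right and bottom edges the other; type $c$ if the left and right edges have one colour and the top and bottom edges the other. *States.* For $1\le i\le n$ and $t\in\{a,b,c\}$, let $$|\sigma^{t}_i\rangle=\sum_{\pi\in LP(n)}\Psi^{t}_i(\pi)\,|\pi\rangle ,$$ where $\Psi^t_i(\pi)$ is the number of $\phi\in Fpl(n,+)$ with $\pi(\phi)=\pi$ such that the $i$-th vertex from the left in the bottom row has type $t$. Call $|s^{t}_{\bullet,j}\rangle=|\sigma^t_{2j-1}\rangle$ for $1\le j\le\lceil n/2\rceil$ (odd sites) and $|s^{t}_{\circ,j}\rangle=|\sigma^t_{2j}\rangle$ for $1\le j\le\lfloor n/2\rfloor$ (even sites). **Proposition (Gyration relations).** For every $1\le j\le\lceil n/2\rceil$, $$e_j|s^{a}_{\bullet,j}\rangle=R^{-1}e_{j-1}|s^{a}_{\bullet,j}\rangle,\qquad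 e_j|s^{b}_{\bullet,j}\rangle=R^{-1}e_{j-1}|s^{b}_{\bullet,j}\rangle,\qquad e_j|s^{c}_{\bullet,j}\rangle=R^{-1}e_{j-1}|s^{c}_{\bullet,j}\rangle,$$ and for every $1\le j\le\lfloor n/2\rfloor$, $$e_j|s^{a}_{\circ,j}\rangle=R^{-1}e_{j-1}|s^{a}_{\circ,j}\rangle,\qquad e_j|s^{b}_{\circ,j}\rangle=R\,e_{j+1}|s^{b}_{\circ,j}\rangle .$$ -/

import Mathlib

namespace FPL

/-! ## Link patterns

The `2n` points on the border of the disk are labelled cyclically by `ZMod (2 * n)`; the label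
`j ∈ {1, …, 2n}` is the class of `j`, so that the label `2n` is the class `0`. -/

/-- A link pattern: a non-crossing perfect matching of the `2n` cyclically ordered points.
`partner x` is the point matched to `x`. -/
@[ext]
structure LinkPattern (n : ℕ) [NeZero n] where
  partner : ZMod (2 * n) → ZMod (2 * n)
  partner_partner : ∀ x, partner (partner x) = x
  partner_ne : ∀ x, partner x ≠ x
  noncrossing : ∀ x y, x.val < y.val → y.val < (partner x).val →
    ¬ (partner x).val < (partner y).val

variable {n : ℕ} [NeZero n]

noncomputable instance : Fintype (LinkPattern n) :=
  Fintype.ofInjective LinkPattern.partner fun _ _ h => LinkPattern.ext h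

theorem one_lt_two_mul : 1 < 2 * n := by
  have := NeZero.pos n
  omega

theorem val_add_one_cases (x : ZMod (2 * n)) :
    (x.val + 1 < 2 * n ∧ (x + 1).val = x.val + 1) ∨
      (x.val + 1 = 2 * n ∧ (x + 1).val = 0) := by
  have h1 : (1 : ZMod (2 * n)).val = 1 := by
    rw [ZMod.val_one_eq_one_mod, Nat.mod_eq_of_lt one_lt_two_mul]
  have hx := ZMod.val_lt x
  rw [ZMod.val_add, h1]
  rcases Nat.lt_or_ge (x.val + 1) (2 * n) with h | h
  · exact Or.inl ⟨h, Nat.mod_eq_of_lt h⟩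
  · have h2 : x.val + 1 = 2 * n := by omega
    exact Or.inr ⟨h2, by rw [h2, Nat.mod_self]⟩

/-- The rotation `R`: the pairs `(i, j)` of `π` become the pairs `(i - 1, j - 1)` of `R π`. -/
def rotate (π : LinkPattern n) : LinkPattern n where
  partner x := π.partner (x + 1) - 1
  partner_partner x := by simp [π.partner_partner]
  partner_ne x h := π.partner_ne (x + 1) (sub_eq_iff_eq_add.mp h)
  noncrossing x y hxy hyx hcr := by
    have hp := π.noncrossing (x + 1) (y + 1)
    have hp' := π.noncrossing (π.partner (y + 1)) (x + 1)
    rw [π.partner_partner] at hp'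
    have a1 := val_add_one_cases x
    have a2 := val_add_one_cases y
    have a3 := val_add_one_cases (π.partner (x + 1) - 1)
    have a4 := val_add_one_cases (π.partner (y + 1) - 1)
    simp only [sub_add_cancel] at a3 a4
    omega

/-- The inverse rotation `R⁻¹`: the pairs `(i, j)` of `π` become `(i + 1, j + 1)`. -/
def unrotate (π : LinkPattern n) : LinkPattern n where
  partner x := π.partner (x - 1) + 1
  partner_partner x := by simp [π.partner_partner]
  partner_ne x h := π.partner_ne (x - 1) (by
    have h2 : π.partner (x - 1) + 1 - 1 = x - 1 := by rw [h]
    simpa using h2)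
  noncrossing x y hxy hyx hcr := by
    have hp := π.noncrossing (x - 1) (y - 1)
    have hp' := π.noncrossing (y - 1) (π.partner (x - 1))
    rw [π.partner_partner] at hp'
    have a1 := val_add_one_cases (x - 1)
    have a2 := val_add_one_cases (y - 1)
    have a3 := val_add_one_cases (π.partner (x - 1))
    have a4 := val_add_one_cases (π.partner (y - 1))
    simp only [sub_add_cancel] at a1 a2
    omega

/-- The rotation `R` as a permutation of the set of link patterns. -/
def R : Equiv.Perm (LinkPattern n) where
  toFun := rotate
  invFun := unrotate
  left_inv π := by ext x; simp [rotate, unrotate]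
  right_inv π := by ext x; simp [rotate, unrotate]

/-- The partner map of `e_j π`: connect `j` with `j + 1`, and the former partners of `j` and
`j + 1` with each other (when `π` already matches `j` with `j + 1`, nothing changes). -/
def arcPartner (j : ZMod (2 * n)) (p : ZMod (2 * n) → ZMod (2 * n)) (x : ZMod (2 * n)) :
    ZMod (2 * n) :=
  if p j = j + 1 then p x
  else if x = j then j + 1
  else if x = j + 1 then j
  else if x = p j then p (j + 1)
  else if x = p (j + 1) then p j
  else p x

theorem arcPartner_arcPartner (π : LinkPattern n) (j x : ZMod (2 * n)) :
    arcPartner j π.partner (arcPartner j π.partner x) = x := by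
  have h1 := π.partner_partner
  have h2 := π.partner_ne
  unfold arcPartner
  grind

theorem arcPartner_ne (π : LinkPattern n) (j x : ZMod (2 * n)) :
    arcPartner j π.partner x ≠ x := by
  have h1 := π.partner_partner
  have h2 := π.partner_ne
  have h3 : (1 : ZMod (2 * n)) ≠ 0 := by
    intro h
    have h4 := congrArg ZMod.val h
    rw [ZMod.val_one_eq_one_mod, Nat.mod_eq_of_lt one_lt_two_mul, ZMod.val_zero] at h4
    omega
  have h5 : j + 1 ≠ j := by simpa using h3
  unfold arcPartner
  grind

theorem arcPartner_zero_noncrossing (π : LinkPattern n) (x y : ZMod (2 * n))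
    (hxy : x.val < y.val) (hyx : y.val < (arcPartner 0 π.partner x).val) :
    ¬ (arcPartner 0 π.partner x).val < (arcPartner 0 π.partner y).val := by
  have h1 := π.partner_partner
  have v0 : (0 : ZMod (2 * n)).val = 0 := ZMod.val_zero
  have v1 : (1 : ZMod (2 * n)).val = 1 := by
    rw [ZMod.val_one_eq_one_mod, Nat.mod_eq_of_lt one_lt_two_mul]
  have inj : ∀ a b : ZMod (2 * n), a.val = b.val → a = b := fun a b h => ZMod.val_injective _ h
  have hnc := π.noncrossing
  revert hyx
  simp only [arcPartner, zero_add]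
  have i0 := inj x 0
  have i1 := inj x 1
  have k0 := inj y 0
  have k1 := inj y 1
  have c1 := hnc x y
  have c2 := hnc x (π.partner 0)
  have c3 := hnc x (π.partner 1)
  have c4 := hnc y (π.partner 0)
  have c5 := hnc y (π.partner 1)
  have c6 := hnc 0 x
  have c7 := hnc 0 y
  have c8 := hnc 1 x
  have c9 := hnc 1 y
  have c10 := hnc 0 1
  have c11 := inj (π.partner 0) 0
  have c12 := inj (π.partner 0) 1
  have c13 := inj (π.partner 1) 0
  have c14 := inj (π.partner 1) 1
  have c15 := π.partner_ne 0
  have c16 := π.partner_ne 1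
  have c17 := h1 0
  have c18 := h1 1
  have c19 := inj x (π.partner 0)
  have c20 := inj x (π.partner 1)
  have c21 := inj y (π.partner 0)
  have c22 := inj y (π.partner 1)
  split_ifs <;> grind

/-- The Temperley-Lieb map `e_j` on link patterns. -/
def e (j : ZMod (2 * n)) (π : LinkPattern n) : LinkPattern n where
  partner := arcPartner j π.partner
  partner_partner := arcPartner_arcPartner π j
  partner_ne := arcPartner_ne π j
  noncrossing := by
    have key : ∀ (k : ℕ) (π : LinkPattern n), ∃ ρ : LinkPattern n,
        ρ.partner = arcPartner (k : ZMod (2 * n)) π.partner := by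
      intro k
      induction k with
      | zero =>
        intro π
        exact ⟨⟨arcPartner 0 π.partner, arcPartner_arcPartner π 0, arcPartner_ne π 0,
          arcPartner_zero_noncrossing π⟩, by simp⟩
      | succ k ih =>
        intro π
        obtain ⟨ρ, hρ⟩ := ih (rotate π)
        refine ⟨unrotate ρ, ?_⟩
        funext x
        simp only [unrotate, hρ, arcPartner, rotate, sub_add_cancel, sub_eq_iff_eq_add,
          Nat.cast_add, Nat.cast_one]
        split_ifs <;> simp_all
    obtain ⟨ρ, hρ⟩ := key j.val π
    rw [ZMod.natCast_zmod_val] at hρ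
    rw [← hρ]
    exact ρ.noncrossing

/-! ## The vector space `ℂ^{LP(n)}` and the operators on it -/

/-- The formal complex vectors on link patterns. The basis vector `|π⟩` is
`Finsupp.single π 1`. -/
abbrev LPSpace (n : ℕ) [NeZero n] := LinkPattern n →₀ ℂ

/-- The operator `e_j`, with `e_j |π⟩ = |e_j π⟩`. -/
noncomputable def eOp (j : ZMod (2 * n)) : LPSpace n →ₗ[ℂ] LPSpace n :=
  Finsupp.lmapDomain ℂ ℂ (e j)

/-- The invertible operator `R`, with `R |π⟩ = |R π⟩`. -/
noncomputable def ROp : LPSpace n ≃ₗ[ℂ] LPSpace n :=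
  Finsupp.domLCongr R

end FPL

namespace FPL

/-! ## Fully-packed loops on the `n × n` square

The vertex `(r, c)` lies in the `r`-th row from the bottom and the `c`-th column from the left,
both counted from `0`. -/

/-- The edges of the `n × n` square, boundary edges included. `Sum.inl (r, k)` is the horizontal
edge of row `r` between the columns `k - 1` and `k`; `Sum.inr (k, c)` is the vertical edge of
column `c` between the rows `k - 1` and `k`. The values `k = 0` and `k = n` give the boundary
edges. -/
abbrev Edge (n : ℕ) := (Fin n × Fin (n + 1)) ⊕ (Fin (n + 1) × Fin n)

abbrev Vertex (n : ℕ) := Fin n × Fin n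

def leftEdge {n : ℕ} (v : Vertex n) : Edge n := Sum.inl (v.1, v.2.castSucc)

def rightEdge {n : ℕ} (v : Vertex n) : Edge n := Sum.inl (v.1, v.2.succ)

def bottomEdge {n : ℕ} (v : Vertex n) : Edge n := Sum.inr (v.1.castSucc, v.2)

def topEdge {n : ℕ} (v : Vertex n) : Edge n := Sum.inr (v.1.succ, v.2)

/-- The four edges adjacent to a vertex. -/
def star {n : ℕ} (v : Vertex n) : Finset (Edge n) :=
  {leftEdge v, rightEdge v, bottomEdge v, topEdge v}

/-- The two colours `b` (black) and `w` (white). -/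
inductive Colour
  | b
  | w
  deriving DecidableEq

instance : Fintype Colour := ⟨{Colour.b, Colour.w}, fun x => by cases x <;> simp⟩

/-- The ice rule: each vertex is adjacent to two black and two white edges. -/
def IceRule {n : ℕ} (φ : Edge n → Colour) : Prop :=
  ∀ v : Vertex n, ((star v).filter fun e => φ e = Colour.b).card = 2 ∧
    ((star v).filter fun e => φ e = Colour.w).card = 2

/-- The `4n` boundary edges in counter-clockwise order, starting with the bottom edge of the
bottom-left vertex: the bottom side from left to right, the right side upwards, the top side from
right to left, the left side downwards. -/
def boundaryEdge {n : ℕ} (k : Fin (4 * n)) : Edge n :=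
  if h₁ : k.val < n then Sum.inr (0, ⟨k.val, h₁⟩)
  else if h₂ : k.val < 2 * n then Sum.inl (⟨k.val - n, by omega⟩, Fin.last n)
  else if h₃ : k.val < 3 * n then Sum.inr (Fin.last n, ⟨3 * n - 1 - k.val, by omega⟩)
  else Sum.inl (⟨4 * n - 1 - k.val, by omega⟩, 0)

/-- The alternating boundary condition `τ₊ = (bwbw…bw)`. -/
def tauPlus {n : ℕ} (k : Fin (4 * n)) : Colour :=
  if k.val % 2 = 0 then Colour.b else Colour.w

/-- The ensemble `Fpl(n, +)`. -/
def Fpl (n : ℕ) : Set (Edge n → Colour) :=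
  {φ | IceRule φ ∧ ∀ k : Fin (4 * n), φ (boundaryEdge k) = tauPlus k}

/-- Two black edges of `φ` with a common vertex: consecutive steps of a black path or cycle. -/
def BlackStep {n : ℕ} (φ : Edge n → Colour) (e e' : Edge n) : Prop :=
  φ e = Colour.b ∧ φ e' = Colour.b ∧ ∃ v : Vertex n, e ∈ star v ∧ e' ∈ star v

/-- The edges `e` and `e'` lie on the same black path or cycle of `φ`. -/
def BlackConnected {n : ℕ} (φ : Edge n → Colour) : Edge n → Edge n → Prop :=
  Relation.ReflTransGen (BlackStep φ)

/-- The black endpoint with label `x`. For `1 ≤ j ≤ 2n`, the label `j` is carried by the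
`(2j - 1)`-th boundary edge, which is the edge number `2 (j - 1)` when counted from `0`. -/
def blackEnd {n : ℕ} [NeZero n] (x : ZMod (2 * n)) : Edge n :=
  boundaryEdge ⟨2 * (x - 1).val, by have := ZMod.val_lt (x - 1); omega⟩

/-- `π(φ) = π`: the link pattern `π` matches two distinct black endpoints exactly if a black path
of `φ` connects them. -/
def HasLinkPattern {n : ℕ} [NeZero n] (φ : Edge n → Colour) (π : LinkPattern n) : Prop :=
  ∀ x y : ZMod (2 * n), π.partner x = y ↔ x ≠ y ∧ BlackConnected φ (blackEnd x) (blackEnd y)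

/-! ## The refined states -/

/-- The three types of configurations of the six-vertex model. -/
inductive VertexType
  | a
  | b
  | c
  deriving DecidableEq

/-- The configuration of `φ` at `v` has the given type. In type `c` the two black edges are
opposite; in types `a` and `b` the black line turns: the two pairs of equally coloured edges are
left–bottom and right–top in type `a`, and left–top and right–bottom in type `b`. -/
def HasType {n : ℕ} (φ : Edge n → Colour) (v : Vertex n) : VertexType → Prop
  | .a => φ (leftEdge v) = φ (bottomEdge v) ∧ φ (rightEdge v) = φ (topEdge v) ∧
      φ (leftEdge v) ≠ φ (rightEdge v)
  | .b => φ (leftEdge v) = φ (topEdge v) ∧ φ (rightEdge v) = φ (bottomEdge v) ∧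
      φ (leftEdge v) ≠ φ (rightEdge v)
  | .c => φ (leftEdge v) = φ (rightEdge v) ∧ φ (bottomEdge v) = φ (topEdge v) ∧
      φ (leftEdge v) ≠ φ (bottomEdge v)

/-- The number of FPL in `Fpl(n, +)` with link pattern `π` whose bottom-row vertex in column `c`
has type `t`. -/
noncomputable def Psi {n : ℕ} [NeZero n] (c : Fin n) (t : VertexType) (π : LinkPattern n) : ℕ :=
  Set.ncard {φ : Edge n → Colour | φ ∈ Fpl n ∧ HasType φ (0, c) t ∧ HasLinkPattern φ π}

/-- The state `∑_π Ψ(π) |π⟩` of `Fpl(n, +)` restricted to type `t` at the bottom-row vertex in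
column `c`. -/
noncomputable def state {n : ℕ} [NeZero n] (c : Fin n) (t : VertexType) : LPSpace n :=
  ∑ π : LinkPattern n, Finsupp.single π (Psi c t π : ℂ)

/-- The state restricted to type `t` at the `(2j - 1)`-th vertex of the bottom row,
`1 ≤ j ≤ ⌈n / 2⌉`. -/
noncomputable def oddState {n : ℕ} [NeZero n] (t : VertexType) (j : ℕ) (h₁ : 1 ≤ j)
    (h₂ : j ≤ (n + 1) / 2) : LPSpace n :=
  state ⟨(2 * j - 1) - 1, by omega⟩ t

/-- The state restricted to type `t` at the `2j`-th vertex of the bottom row,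
`1 ≤ j ≤ ⌊n / 2⌋`. -/
noncomputable def evenState {n : ℕ} [NeZero n] (t : VertexType) (j : ℕ) (h₁ : 1 ≤ j)
    (h₂ : j ≤ n / 2) : LPSpace n :=
  state ⟨2 * j - 1, by omega⟩ t

end FPL

/-!
Colour the faces of the square like a chessboard. Half gyration exchanges the colours around all
faces of one parity except the alternating ones. It moves the black ends to the other boundary
edges and keeps the way in which black paths connect them: two black edges around a face of the
given parity that is not alternating are connected before the step as well as after it, and at an
alternating face nothing changes. Hence the two half gyrations together rotate the link pattern.

Exchanging the colours around an alternating face in the bottom row joins the paths of two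
neighbouring ends, or undoes this, and so does not change `e_j π`. If such a face is exchanged
before the half gyration, then the colours of all edges at its two bottom corners are reversed,
which preserves the type of these vertices. Choosing the face to the right or to the left of the
given vertex yields permutations of the fully-packed loops of fixed type that realize the relations.
In type `a` the face to the right of the vertex is not alternating, and in type `b` the face to the
left is not alternating, which accounts for the relations at the even sites.

That the black paths define a link pattern at all is a discrete Jordan argument. A set of edges
that meets each vertex evenly has a potential modulo 2 on the faces. Applied to a black path, the
potential is constant along any other path, so the paths do not cross; on the boundary it shows
that a black path which starts at the boundary ends at a second boundary edge.
-/

namespace FPL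

/-! ## Stars, cells and the ice rule -/

section Cells

variable {n ε : ℕ} {φ ψ : Edge n → Colour} {v : Vertex n} {P : ℕ × ℕ} {e f p q p' q' : Edge n}

/-- The opposite colour. -/
def Colour.flip : Colour → Colour
  | .b => .w
  | .w => .b

@[simp] theorem Colour.flip_flip (x : Colour) : x.flip.flip = x := by cases x <;> rfl

@[simp] theorem Colour.flip_inj {x y : Colour} : x.flip = y.flip ↔ x = y := by
  cases x <;> cases y <;> simp [Colour.flip]

@[simp] theorem Colour.flip_eq_b {x : Colour} : x.flip = .b ↔ x ≠ .b := by
  cases x <;> simp [Colour.flip]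

theorem Colour.eq_of_ne_of_ne {x y z : Colour} (hx : x ≠ z) (hy : y ≠ z) : x = y := by
  cases x <;> cases y <;> cases z <;> simp_all

theorem mem_star_inl {r : Fin n} {k : Fin (n + 1)} :
    .inl (r, k) ∈ star v ↔ v.1.val = r ∧ (v.2.val = k ∨ v.2.val + 1 = k) := by
  simp [star, leftEdge, rightEdge, bottomEdge, topEdge, Fin.ext_iff]
  omega

theorem mem_star_inr {k : Fin (n + 1)} {c : Fin n} :
    .inr (k, c) ∈ star v ↔ v.2.val = c ∧ (v.1.val = k ∨ v.1.val + 1 = k) := by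
  simp [star, leftEdge, rightEdge, bottomEdge, topEdge, Fin.ext_iff]
  omega

/-- The cell of parity `ε` on the border of an edge. The cell `(r, c)`, `0 ≤ r, c ≤ n`, is the
face with the corners `(r - 1, c - 1)`, `(r - 1, c)`, `(r, c - 1)` and `(r, c)`, as far as they
exist; its parity is that of `r + c`. The two faces at an edge are its cells of parity `0` and
`1`. -/
def cell (ε : ℕ) : Edge n → ℕ × ℕ
  | .inl (r, k) => (r + (r + k + ε) % 2, k)
  | .inr (k, c) => (k, c + (k + c + ε) % 2)

/-- The star of `v` consists of the edges `p` and `q` on one cell of parity `ε` and the edges `p'`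
and `q'` on another one. -/
structure IsStarSplit (ε : ℕ) (v : Vertex n) (p q p' q' : Edge n) : Prop where
  star_eq : star v = {p, q, p', q'}
  cell_eq : cell ε q = cell ε p
  cell_eq' : cell ε q' = cell ε p'
  cell_ne : cell ε p ≠ cell ε p'
  isLeft_ne : p.isLeft ≠ q.isLeft
  isLeft_ne' : p'.isLeft ≠ q'.isLeft

namespace IsStarSplit

theorem left_mem (h : IsStarSplit ε v p q p' q') : p ∈ star v := by simp [h.star_eq]

theorem right_mem (h : IsStarSplit ε v p q p' q') : q ∈ star v := by simp [h.star_eq]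

theorem symm (h : IsStarSplit ε v p q p' q') : IsStarSplit ε v p' q' p q where
  star_eq := by rw [h.star_eq]; grind
  cell_eq := h.cell_eq'
  cell_eq' := h.cell_eq
  cell_ne := h.cell_ne.symm
  isLeft_ne := h.isLeft_ne'
  isLeft_ne' := h.isLeft_ne

theorem swap (h : IsStarSplit ε v p q p' q') : IsStarSplit ε v q p p' q' where
  star_eq := by rw [h.star_eq]; grind
  cell_eq := h.cell_eq.symm
  cell_eq' := h.cell_eq'
  cell_ne := h.cell_eq ▸ h.cell_ne
  isLeft_ne := h.isLeft_ne.symm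
  isLeft_ne' := h.isLeft_ne'

theorem card_iff (h : IsStarSplit ε v p q p' q') :
    (((star v).filter fun e => φ e = .b).card = 2 ∧
        ((star v).filter fun e => φ e = .w).card = 2) ↔
      (φ p ≠ φ q ∧ φ p' ≠ φ q') ∨ (φ p = φ q ∧ φ p' = φ q' ∧ φ p ≠ φ p') := by
  have hpq : p ≠ q := by rintro rfl; exact h.isLeft_ne rfl
  have hpq' : p' ≠ q' := by rintro rfl; exact h.isLeft_ne' rfl
  have hpp' : p ≠ p' := by rintro rfl; exact h.cell_ne rfl
  have hp_q' : p ≠ q' := by rintro rfl; exact h.cell_ne h.cell_eq'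
  have hqp' : q ≠ p' := by rintro rfl; exact h.cell_ne h.cell_eq.symm
  have hqq' : q ≠ q' := by rintro rfl; exact h.cell_ne (h.cell_eq.symm.trans h.cell_eq')
  simp only [h.star_eq, Finset.filter_insert, Finset.filter_singleton]
  cases φ p <;> cases φ q <;> cases φ p' <;> cases φ q' <;> simp [*]

end IsStarSplit

theorem isStarSplit_of_even (h : (v.1.val + v.2.val + ε) % 2 = 0) :
    IsStarSplit ε v (leftEdge v) (bottomEdge v) (rightEdge v) (topEdge v) := by
  refine ⟨by grind [star], ?_, ?_, ?_, ?_, ?_⟩ <;>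
    simp only [cell, leftEdge, rightEdge, bottomEdge, topEdge, ne_eq, Prod.mk.injEq,
      Fin.val_castSucc, Fin.val_succ, Sum.isLeft_inl, Sum.isLeft_inr, Bool.true_eq_false,
      not_false_eq_true] <;> omega

theorem isStarSplit_of_odd (h : (v.1.val + v.2.val + ε) % 2 = 1) :
    IsStarSplit ε v (leftEdge v) (topEdge v) (rightEdge v) (bottomEdge v) := by
  refine ⟨by grind [star], ?_, ?_, ?_, ?_, ?_⟩ <;>
    simp only [cell, leftEdge, rightEdge, bottomEdge, topEdge, ne_eq, Prod.mk.injEq,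
      Fin.val_castSucc, Fin.val_succ, Sum.isLeft_inl, Sum.isLeft_inr, Bool.true_eq_false,
      not_false_eq_true] <;> omega

theorem exists_isStarSplit (ε : ℕ) (v : Vertex n) : ∃ p q p' q', IsStarSplit ε v p q p' q' := by
  rcases Nat.mod_two_eq_zero_or_one (v.1.val + v.2.val + ε) with h | h
  exacts [⟨_, _, _, _, isStarSplit_of_even h⟩, ⟨_, _, _, _, isStarSplit_of_odd h⟩]

theorem exists_isStarSplit_of_mem (ε : ℕ) (he : e ∈ star v) :
    ∃ q p' q', IsStarSplit ε v e q p' q' := by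
  obtain ⟨p, q, p', q', h⟩ := exists_isStarSplit ε v
  have he' := he
  simp only [h.star_eq, Finset.mem_insert, Finset.mem_singleton] at he'
  rcases he' with rfl | rfl | rfl | rfl
  exacts [⟨_, _, _, h⟩, ⟨_, _, _, h.swap⟩, ⟨_, _, _, h.symm⟩, ⟨_, _, _, h.symm.swap⟩]

theorem IceRule.colour (hφ : IceRule φ) (h : IsStarSplit ε v p q p' q') :
    (φ p ≠ φ q ∧ φ p' ≠ φ q') ∨ (φ p = φ q ∧ φ p' = φ q' ∧ φ p ≠ φ p') :=
  h.card_iff.1 (hφ v)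

/-- The cell `P` of parity `ε` is an inner one, and its four edges are coloured alternately. -/
def Alternating (ε : ℕ) (φ : Edge n → Colour) (P : ℕ × ℕ) : Prop :=
  (P.1 ∈ Set.Ioo 0 n ∧ P.2 ∈ Set.Ioo 0 n) ∧
    ∀ e f, cell ε e = P → cell ε f = P → (φ e = φ f ↔ e.isLeft = f.isLeft)

theorem Alternating.ne (h : IsStarSplit ε v p q p' q') (hP : Alternating ε φ (cell ε p)) :
    φ p ≠ φ q :=
  fun hpq => h.isLeft_ne ((hP.2 p q rfl h.cell_eq).1 hpq)

theorem Alternating.iff_of_eqOn (h : ∀ e, cell ε e = P → ψ e = φ e) :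
    Alternating ε ψ P ↔ Alternating ε φ P := by
  refine and_congr_right fun _ => forall₂_congr fun e f => forall₂_congr fun he hf => ?_
  rw [h e he, h f hf]

theorem Alternating.iff_of_eqOn_flip (h : ∀ e, cell ε e = P → ψ e = (φ e).flip) :
    Alternating ε ψ P ↔ Alternating ε φ P := by
  refine and_congr_right fun _ => forall₂_congr fun e f => forall₂_congr fun he hf => ?_
  rw [h e he, h f hf, Colour.flip_inj]

theorem IceRule.not_alternating (hφ : IceRule φ) (h : IsStarSplit ε v p q p' q')
    (hpq : φ p = φ q) : ¬ Alternating ε φ (cell ε p) ∧ ¬ Alternating ε φ (cell ε p') := by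
  have hpq' : φ p' = φ q' := ((hφ.colour h).resolve_left fun h => h.1 hpq).2.1
  exact ⟨fun hP => hP.ne h hpq, fun hP => hP.ne h.symm hpq'⟩

open Classical in
/-- Exchange the colours on the borders of the cells of parity `ε` that satisfy `F`. -/
noncomputable def flipCells (ε : ℕ) (F : ℕ × ℕ → Prop) (φ : Edge n → Colour) : Edge n → Colour :=
  fun e => if F (cell ε e) then (φ e).flip else φ e

theorem IceRule.flipCells {F : ℕ × ℕ → Prop} (hφ : IceRule φ)
    (hF : ∀ v p q p' q', IsStarSplit ε v p q p' q' → φ p = φ q →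
      (F (cell ε p) ↔ F (cell ε p'))) :
    IceRule (flipCells ε F φ) := by
  intro v
  obtain ⟨p, q, p', q', h⟩ := exists_isStarSplit ε v
  rw [h.card_iff]
  unfold FPL.flipCells
  rw [h.cell_eq, h.cell_eq']
  rcases hφ.colour h with ⟨hpq, hpq'⟩ | ⟨hpq, hpq', hpp'⟩
  · left
    constructor <;> split_ifs <;> simpa
  · right
    have hF := hF v p q p' q' h hpq
    by_cases hp : F (cell ε p)
    · simpa [hp, hF.1 hp, hpq, hpq'] using hpq ▸ hpq' ▸ hpp'
    · simpa [hp, mt hF.2 hp, hpq, hpq'] using hpq ▸ hpq' ▸ hpp'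

/-- Half gyration: exchange the colours on the borders of all cells of parity `ε`, except for the
alternating cells. -/
noncomputable def gyrate (ε : ℕ) (φ : Edge n → Colour) : Edge n → Colour :=
  flipCells ε (fun P => ¬ Alternating ε φ P) φ

/-- Exchange the colours on the border of the cell `P` of parity `ε` if it is alternating. -/
noncomputable def swapCell (ε : ℕ) (P : ℕ × ℕ) (φ : Edge n → Colour) : Edge n → Colour :=
  flipCells ε (fun Q => Q = P ∧ Alternating ε φ P) φ

theorem gyrate_of_alternating (h : Alternating ε φ (cell ε e)) : gyrate ε φ e = φ e := by
  simp [gyrate, flipCells, h]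

theorem gyrate_of_not_alternating (h : ¬ Alternating ε φ (cell ε e)) :
    gyrate ε φ e = (φ e).flip := by
  simp [gyrate, flipCells, h]

theorem swapCell_of_not_alternating (h : ¬ Alternating ε φ P) : swapCell ε P φ = φ := by
  funext e
  simp [swapCell, flipCells, h]

theorem swapCell_of_cell_ne (he : cell ε e ≠ P) : swapCell ε P φ e = φ e := by
  simp [swapCell, flipCells, he]

theorem swapCell_of_alternating (h : Alternating ε φ P) (he : cell ε e = P) :
    swapCell ε P φ e = (φ e).flip := by
  simp [swapCell, flipCells, h, he]

theorem alternating_gyrate_iff : Alternating ε (gyrate ε φ) P ↔ Alternating ε φ P := by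
  by_cases h : Alternating ε φ P
  · exact Alternating.iff_of_eqOn fun e he => gyrate_of_alternating (he ▸ h)
  · exact Alternating.iff_of_eqOn_flip fun e he => gyrate_of_not_alternating (he ▸ h)

theorem alternating_swapCell_iff : Alternating ε (swapCell ε P φ) P ↔ Alternating ε φ P := by
  by_cases h : Alternating ε φ P
  · exact Alternating.iff_of_eqOn_flip fun e he => swapCell_of_alternating h he
  · rw [swapCell_of_not_alternating h]

theorem gyrate_gyrate (ε : ℕ) (φ : Edge n → Colour) : gyrate ε (gyrate ε φ) = φ := by
  funext e
  by_cases h : Alternating ε φ (cell ε e)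
  · rw [gyrate_of_alternating (alternating_gyrate_iff.2 h), gyrate_of_alternating h]
  · rw [gyrate_of_not_alternating (mt alternating_gyrate_iff.1 h), gyrate_of_not_alternating h,
      Colour.flip_flip]

theorem swapCell_swapCell (ε : ℕ) (P : ℕ × ℕ) (φ : Edge n → Colour) :
    swapCell ε P (swapCell ε P φ) = φ := by
  by_cases h : Alternating ε φ P
  · funext e
    by_cases he : cell ε e = P
    · rw [swapCell_of_alternating (alternating_swapCell_iff.2 h) he,
        swapCell_of_alternating h he, Colour.flip_flip]
    · rw [swapCell_of_cell_ne he, swapCell_of_cell_ne he]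
  · rw [swapCell_of_not_alternating h, swapCell_of_not_alternating h]

theorem IceRule.gyrate (hφ : IceRule φ) (ε : ℕ) : IceRule (gyrate ε φ) :=
  hφ.flipCells fun _ _ _ _ _ h hpq => by simp [hφ.not_alternating h hpq]

theorem IceRule.swapCell (hφ : IceRule φ) (ε : ℕ) (P : ℕ × ℕ) : IceRule (swapCell ε P φ) := by
  refine hφ.flipCells fun v p q p' q' h hpq => iff_of_false ?_ ?_
  · rintro ⟨rfl, hP⟩
    exact (hφ.not_alternating h hpq).1 hP
  · rintro ⟨rfl, hP⟩
    exact (hφ.not_alternating h hpq).2 hP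

end Cells

/-! ## Alternating boundary conditions -/

section Boundary

variable {n ε : ℕ} {s : Fin 2} {φ : Edge n → Colour} {P : ℕ × ℕ}

/-- The fully-packed loops whose `k`-th boundary edge, counted from `0`, is black exactly if `k` has
the parity of `s`. -/
def FplAt (n : ℕ) (s : Fin 2) : Set (Edge n → Colour) :=
  {φ | IceRule φ ∧ ∀ k : Fin (4 * n), φ (boundaryEdge k) = .b ↔ k.val % 2 = s}

theorem fplAt_zero (n : ℕ) : FplAt n 0 = Fpl n := by
  ext φ
  refine and_congr_right fun _ => forall_congr' fun k => ?_
  rw [tauPlus]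
  cases φ (boundaryEdge k) <;> simp

/-- The cell between the boundary edges `k - 1` and `k`, counted from `0`. -/
def boundaryCell (n k : ℕ) : ℕ × ℕ :=
  if k ≤ n then (0, k) else if k ≤ 2 * n then (k - n, n) else if k ≤ 3 * n then (n, 3 * n - k)
  else (4 * n - k, 0)

theorem boundaryCell_four_mul (n : ℕ) : boundaryCell n (4 * n) = boundaryCell n 0 := by
  grind [boundaryCell]

theorem cell_boundaryEdge (ε : ℕ) (k : Fin (4 * n)) :
    cell ε (boundaryEdge k : Edge n) = boundaryCell n (k + (k + ε) % 2) := by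
  have hk := k.isLt
  unfold boundaryEdge boundaryCell
  split_ifs <;>
    simp only [cell, Prod.mk.injEq, Fin.val_zero, Fin.val_last, true_and, and_true] <;> omega

theorem boundaryEdge_injective : Function.Injective (boundaryEdge : Fin (4 * n) → Edge n) := by
  intro k l h
  unfold boundaryEdge at h
  split_ifs at h <;> simp [Fin.ext_iff] at h ⊢ <;> omega

theorem boundaryEdge_left (r : Fin n) :
    boundaryEdge ⟨4 * n - 1 - r, by omega⟩ = (.inl (r, 0) : Edge n) := by
  rw [boundaryEdge, dif_neg (by simp only; omega), dif_neg (by simp only; omega),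
    dif_neg (by simp only; omega)]
  simp only [Sum.inl.injEq, Prod.mk.injEq, Fin.ext_iff, and_true]
  omega

theorem boundaryEdge_right (r : Fin n) :
    boundaryEdge ⟨n + r, by omega⟩ = (.inl (r, Fin.last n) : Edge n) := by
  rw [boundaryEdge, dif_neg (by simp), dif_pos (by simp only; omega)]
  simp

theorem boundaryEdge_bottom (c : Fin n) :
    boundaryEdge ⟨c, by omega⟩ = (.inr (0, c) : Edge n) := by
  simp [boundaryEdge]

theorem boundaryEdge_top (c : Fin n) :
    boundaryEdge ⟨3 * n - 1 - c, by omega⟩ = (.inr (Fin.last n, c) : Edge n) := by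
  rw [boundaryEdge, dif_neg (by simp only; omega), dif_neg (by simp only; omega),
    dif_pos (by simp only; omega)]
  simp only [Sum.inr.injEq, Prod.mk.injEq, Fin.ext_iff, true_and]
  omega

theorem not_alternating_boundaryEdge (ε : ℕ) (φ : Edge n → Colour) (k : Fin (4 * n)) :
    ¬ Alternating ε φ (cell ε (boundaryEdge k)) := by
  rintro ⟨⟨h₁, h₂⟩, -⟩
  rw [cell_boundaryEdge, Set.mem_Ioo] at h₁ h₂
  grind [boundaryCell]

theorem gyrate_boundaryEdge (ε : ℕ) (φ : Edge n → Colour) (k : Fin (4 * n)) :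
    gyrate ε φ (boundaryEdge k) = (φ (boundaryEdge k)).flip :=
  gyrate_of_not_alternating (not_alternating_boundaryEdge ε φ k)

theorem swapCell_boundaryEdge (ε : ℕ) (P : ℕ × ℕ) (φ : Edge n → Colour) (k : Fin (4 * n)) :
    swapCell ε P φ (boundaryEdge k) = φ (boundaryEdge k) := by
  by_cases h : Alternating ε φ P
  · exact swapCell_of_cell_ne fun h' => not_alternating_boundaryEdge ε φ k (h' ▸ h)
  · rw [swapCell_of_not_alternating h]

theorem gyrate_mem (hφ : φ ∈ FplAt n s) (ε : ℕ) : gyrate ε φ ∈ FplAt n (s + 1) := by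
  refine ⟨hφ.1.gyrate ε, fun k => ?_⟩
  rw [gyrate_boundaryEdge, Colour.flip_eq_b, Ne, hφ.2]
  fin_cases s <;> simp

theorem swapCell_mem (hφ : φ ∈ FplAt n s) (ε : ℕ) (P : ℕ × ℕ) : swapCell ε P φ ∈ FplAt n s :=
  ⟨hφ.1.swapCell ε P, fun k => by rw [swapCell_boundaryEdge, hφ.2]⟩

theorem inner_of_black_inl (hφ : φ ∈ FplAt n s) {r r' : Fin n} {k : Fin (n + 1)}
    (hr : r'.val = r + 1) (h : φ (.inl (r, k)) = .b) (h' : φ (.inl (r', k)) = .b) :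
    k.val ∈ Set.Ioo 0 n := by
  by_contra hk
  obtain rfl | rfl : k = 0 ∨ k = Fin.last n := by
    simp only [Set.mem_Ioo, Fin.ext_iff, Fin.val_zero, Fin.val_last] at hk ⊢
    omega
  · rw [← boundaryEdge_left, hφ.2] at h h'
    simp only at h h'
    omega
  · rw [← boundaryEdge_right, hφ.2] at h h'
    simp only at h h'
    omega

theorem inner_of_black_inr (hφ : φ ∈ FplAt n s) {k : Fin (n + 1)} {c c' : Fin n}
    (hc : c'.val = c + 1) (h : φ (.inr (k, c)) = .b) (h' : φ (.inr (k, c')) = .b) :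
    k.val ∈ Set.Ioo 0 n := by
  by_contra hk
  obtain rfl | rfl : k = 0 ∨ k = Fin.last n := by
    simp only [Set.mem_Ioo, Fin.ext_iff, Fin.val_zero, Fin.val_last] at hk ⊢
    omega
  · rw [← boundaryEdge_bottom, hφ.2] at h h'
    simp only at h h'
    omega
  · rw [← boundaryEdge_top, hφ.2] at h h'
    simp only at h h'
    omega

end Boundary

/-! ## Black paths and cells -/

section Connected

variable {n ε : ℕ} {s : Fin 2} {φ : Edge n → Colour} {v : Vertex n} {e f g p q p' q' : Edge n}

theorem BlackConnected.of_mem_star (he : φ e = .b) (hf : φ f = .b) (hev : e ∈ star v)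
    (hfv : f ∈ star v) : BlackConnected φ e f :=
  .single ⟨he, hf, v, hev, hfv⟩

instance : Std.Symm (BlackStep φ) :=
  ⟨fun _ _ ⟨he, hf, v, hev, hfv⟩ => ⟨hf, he, v, hfv, hev⟩⟩

theorem BlackConnected.symm (h : BlackConnected φ e f) : BlackConnected φ f e :=
  Relation.ReflTransGen.stdSymm.symm _ _ h

theorem BlackConnected.black (h : BlackConnected φ e f) (he : φ e = .b) : φ f = .b := by
  cases h with
  | refl => exact he
  | tail _ h => exact h.2.1

theorem exists_mem_star_of_cell_eq (h : cell ε e = cell ε f) (hef : e.isLeft ≠ f.isLeft) :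
    ∃ v : Vertex n, e ∈ star v ∧ f ∈ star v := by
  rcases e with ⟨r, k⟩ | ⟨k, c⟩ <;> rcases f with ⟨r', k'⟩ | ⟨k', c'⟩
  · exact absurd rfl hef
  · refine ⟨(r, c'), ?_⟩
    simp only [cell, Prod.mk.injEq] at h
    simp only [mem_star_inl, mem_star_inr, true_and]
    omega
  · refine ⟨(r', c), ?_⟩
    simp only [cell, Prod.mk.injEq] at h
    simp only [mem_star_inl, mem_star_inr, true_and]
    omega
  · exact absurd rfl hef

theorem eq_or_eq_of_cell_eq (hf : cell ε f = cell ε e) (hg : cell ε g = cell ε e)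
    (hef : e.isLeft = f.isLeft) (heg : e.isLeft = g.isLeft) (hne : e ≠ f) : g = e ∨ g = f := by
  rcases e with ⟨r, k⟩ | ⟨k, c⟩ <;> rcases f with ⟨r', k'⟩ | ⟨k', c'⟩ <;>
    rcases g with ⟨r'', k''⟩ | ⟨k'', c''⟩ <;>
    simp [cell, Fin.ext_iff] at * <;> omega

theorem inner_of_cell_eq (hφ : φ ∈ FplAt n s) (he : φ e = .b) (hf : φ f = .b)
    (h : cell ε f = cell ε e) (hef : e.isLeft = f.isLeft) (hne : e ≠ f) :
    (cell ε e).1 ∈ Set.Ioo 0 n ∧ (cell ε e).2 ∈ Set.Ioo 0 n := by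
  rcases e with ⟨r, k⟩ | ⟨k, c⟩ <;> rcases f with ⟨r', k'⟩ | ⟨k', c'⟩
  · simp only [cell, Prod.mk.injEq] at h ⊢
    obtain rfl : k' = k := Fin.ext h.2
    have hr : r.val ≠ r' := fun hr => hne (by rw [Fin.ext hr])
    refine ⟨⟨by omega, by omega⟩, ?_⟩
    obtain hr | hr : r'.val = r + 1 ∨ r.val = r' + 1 := by omega
    exacts
      [inner_of_black_inl hφ hr he hf, inner_of_black_inl hφ hr hf he]
  · cases hef
  · cases hef
  · simp only [cell, Prod.mk.injEq] at h ⊢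
    obtain rfl : k' = k := Fin.ext h.1
    have hc : c.val ≠ c' := fun hc => hne (by rw [Fin.ext hc])
    refine ⟨?_, ⟨by omega, by omega⟩⟩
    obtain hc | hc : c'.val = c + 1 ∨ c.val = c' + 1 := by omega
    exacts
      [inner_of_black_inr hφ hc he hf, inner_of_black_inr hφ hc hf he]

theorem exists_black_of_not_alternating (hφ : φ ∈ FplAt n s) (he : φ e = .b) (hf : φ f = .b)
    (h : cell ε f = cell ε e) (hef : e.isLeft = f.isLeft) (hne : e ≠ f)
    (hP : ¬ Alternating ε φ (cell ε e)) :
    ∃ g, φ g = .b ∧ cell ε g = cell ε e ∧ e.isLeft ≠ g.isLeft := by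
  by_contra! hall
  have hblack : ∀ g, cell ε g = cell ε e → (φ g = .b ↔ e.isLeft = g.isLeft) := by
    refine fun g hg => ⟨fun hgb => hall g hgb hg, fun heg => ?_⟩
    rcases eq_or_eq_of_cell_eq h hg hef heg hne with rfl | rfl <;> assumption
  refine hP ⟨inner_of_cell_eq hφ he hf h hef hne, fun x y hx hy => ?_⟩
  have hxb := hblack x hx
  have hyb := hblack y hy
  cases hφx : φ x <;> cases hφy : φ y <;> grind

theorem blackConnected_of_cell_eq (hφ : φ ∈ FplAt n s) (he : φ e = .b) (hf : φ f = .b)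
    (h : cell ε f = cell ε e) (hP : ¬ Alternating ε φ (cell ε e)) : BlackConnected φ e f := by
  have of_isLeft_ne : ∀ {x y}, φ x = .b → φ y = .b → cell ε x = cell ε y →
      x.isLeft ≠ y.isLeft → BlackConnected φ x y := by
    intro x y hx hy hxy hne
    obtain ⟨v, hxv, hyv⟩ := exists_mem_star_of_cell_eq hxy hne
    exact .of_mem_star hx hy hxv hyv
  by_cases hef : e.isLeft = f.isLeft
  · rcases eq_or_ne e f with rfl | hne
    · exact .refl
    obtain ⟨g, hg, hge, heg⟩ := exists_black_of_not_alternating hφ he hf h hef hne hP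
    exact (of_isLeft_ne he hg hge.symm heg).trans
      (of_isLeft_ne hg hf (hge.trans h.symm) (hef ▸ heg.symm))
  · exact of_isLeft_ne he hf h.symm hef

end Connected

/-! ## Gyration preserves connectivity -/

section Gyration

variable {n ε : ℕ} {s : Fin 2} {φ ψ : Edge n → Colour} {v : Vertex n} {e f e' f' : Edge n}

open Classical in
/-- The strand of a black edge: the edge itself if its cell of parity `ε` is alternating, and that
cell otherwise. By `blackConnected_of_strand_eq`, black edges on the same strand are connected,
and gyration permutes the black edges within the strands. -/
noncomputable def strand (ε : ℕ) (φ : Edge n → Colour) (e : Edge n) : Edge n ⊕ (ℕ × ℕ) :=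
  if Alternating ε φ (cell ε e) then .inl e else .inr (cell ε e)

/-- Two strands with black edges at a common vertex. -/
def StrandStep (ε : ℕ) (φ : Edge n → Colour) (x y : Edge n ⊕ (ℕ × ℕ)) : Prop :=
  ∃ e f, BlackStep φ e f ∧ strand ε φ e = x ∧ strand ε φ f = y

theorem strand_boundaryEdge (ε : ℕ) (φ : Edge n → Colour) (k : Fin (4 * n)) :
    strand ε φ (boundaryEdge k) = .inr (cell ε (boundaryEdge k)) :=
  if_neg (not_alternating_boundaryEdge ε φ k)

theorem strand_gyrate (ε : ℕ) (φ : Edge n → Colour) : strand ε (gyrate ε φ) = strand ε φ := by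
  classical
  funext e
  exact if_congr alternating_gyrate_iff rfl rfl

theorem strand_eq_of_cell_eq (hP : ¬ Alternating ε φ (cell ε e)) (h : cell ε f = cell ε e) :
    strand ε φ f = strand ε φ e := by
  rw [strand, strand, h, if_neg hP, if_neg hP]

theorem blackConnected_of_strand_eq (hφ : φ ∈ FplAt n s) (he : φ e = .b) (hf : φ f = .b)
    (h : strand ε φ e = strand ε φ f) : BlackConnected φ e f := by
  unfold strand at h
  split_ifs at h with hP
  · rw [Sum.inl.inj h]
    exact .refl
  · exact blackConnected_of_cell_eq hφ he hf (Sum.inr.inj h).symm hP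

theorem blackConnected_of_strandStep (hφ : φ ∈ FplAt n s) (he : φ e = .b) (hf : φ f = .b)
    (h : Relation.ReflTransGen (StrandStep ε φ) (strand ε φ e) (strand ε φ f)) :
    BlackConnected φ e f := by
  generalize hy : strand ε φ f = y at h
  induction h generalizing f with
  | refl => exact blackConnected_of_strand_eq hφ he hf hy.symm
  | tail _ hstep ih =>
    obtain ⟨g, g', hgg', rfl, rfl⟩ := hstep
    exact ((ih hgg'.1 rfl).tail hgg').trans (blackConnected_of_strand_eq hφ hgg'.2.1 hf hy.symm)

theorem exists_strand_eq_gyrate (hφ : IceRule φ) (hev : e ∈ star v) (he : φ e = .b) :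
    (∃ g ∈ star v, gyrate ε φ g = .b ∧ strand ε φ g = strand ε φ e) ∨
      ∀ f ∈ star v, φ f = .b → strand ε φ f = strand ε φ e := by
  by_cases hP : Alternating ε φ (cell ε e)
  · exact .inl ⟨e, hev, by rw [gyrate_of_alternating hP, he], rfl⟩
  obtain ⟨q, p', q', h⟩ := exists_isStarSplit_of_mem ε hev
  have hq := strand_eq_of_cell_eq hP h.cell_eq
  by_cases hqb : φ q = .b
  · right
    obtain ⟨-, hp'q', hep'⟩ := (hφ.colour h).resolve_left fun h => h.1 (he.trans hqb.symm)
    intro f hf hfb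
    simp only [h.star_eq, Finset.mem_insert, Finset.mem_singleton] at hf
    rcases hf with rfl | rfl | rfl | rfl
    · rfl
    · exact hq
    · exact absurd (he.trans hfb.symm) hep'
    · exact absurd (he.trans (hp'q'.trans hfb).symm) hep'
  · left
    refine ⟨q, h.right_mem, ?_, hq⟩
    rw [gyrate_of_not_alternating (h.cell_eq ▸ hP), Colour.flip_eq_b]
    exact hqb

theorem StrandStep.gyrate {x y : Edge n ⊕ (ℕ × ℕ)} (hφ : IceRule φ) (h : StrandStep ε φ x y) :
    x = y ∨ StrandStep ε (gyrate ε φ) x y := by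
  obtain ⟨e, f, ⟨he, hf, v, hev, hfv⟩, rfl, rfl⟩ := h
  rcases exists_strand_eq_gyrate (ε := ε) hφ hev he with ⟨e', hev', he', hee'⟩ | hall
  · rcases exists_strand_eq_gyrate (ε := ε) hφ hfv hf with ⟨f', hfv', hf', hff'⟩ | hall
    · refine .inr ⟨e', f', ⟨he', hf', v, hev', hfv'⟩, ?_⟩
      simp only [strand_gyrate, hee', hff', and_self]
    · exact .inl (hall e hev he)
  · exact .inl (hall f hfv hf).symm

theorem BlackConnected.gyrate (hφ : φ ∈ FplAt n s) (h : BlackConnected φ e f)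
    (he' : gyrate ε φ e' = .b) (hf' : gyrate ε φ f' = .b) (hee' : strand ε φ e' = strand ε φ e)
    (hff' : strand ε φ f' = strand ε φ f) : BlackConnected (gyrate ε φ) e' f' := by
  refine blackConnected_of_strandStep (ε := ε) (gyrate_mem hφ ε) he' hf' ?_
  rw [strand_gyrate, hee', hff']
  have hclosed : StrandStep ε φ ≤ Relation.ReflTransGen (StrandStep ε (FPL.gyrate ε φ)) := by
    intro x y hstep
    rcases hstep.gyrate hφ.1 with rfl | hstep'
    exacts [.refl, .single hstep']
  exact Relation.reflTransGen_closed hclosed _ _ (h.lift _ fun _ _ hstep => ⟨_, _, hstep, rfl, rfl⟩)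

end Gyration

/-! ## Link patterns of fully-packed loops -/

section LinkedBy

variable {n : ℕ} [NeZero n] {s : Fin 2} {φ : Edge n → Colour} {x : ZMod (2 * n)}

/-- The black endpoint with label `x` of the fully-packed loops in `FplAt n s`. -/
def endAt (s : Fin 2) (x : ZMod (2 * n)) : Edge n :=
  boundaryEdge ⟨2 * (x - 1).val + s, by have := ZMod.val_lt (x - 1); omega⟩

theorem endAt_black (hφ : φ ∈ FplAt n s) (x : ZMod (2 * n)) : φ (endAt s x) = .b := by
  rw [endAt, hφ.2]
  simp only
  omega

theorem endAt_injective (s : Fin 2) : Function.Injective (endAt s : ZMod (2 * n) → Edge n) := by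
  intro x y h
  have hval := Fin.ext_iff.1 (boundaryEdge_injective h)
  simp only at hval
  exact sub_left_inj.1 (ZMod.val_injective _ (a₁ := x - 1) (a₂ := y - 1) (by omega))

theorem exists_endAt_eq (hφ : φ ∈ FplAt n s) {k : Fin (4 * n)} (hk : φ (boundaryEdge k) = .b) :
    ∃ x : ZMod (2 * n), endAt s x = boundaryEdge k := by
  have hks := (hφ.2 k).1 hk
  have hval : ((k.val / 2 : ℕ) + 1 - 1 : ZMod (2 * n)).val = k / 2 := by
    rw [add_sub_cancel_right, ZMod.val_natCast_of_lt (by omega)]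
  refine ⟨(k.val / 2 : ℕ) + 1, congrArg boundaryEdge (Fin.ext ?_)⟩
  simp only [hval]
  omega

theorem cell_endAt (ε : ℕ) (s : Fin 2) (x : ZMod (2 * n)) :
    cell ε (endAt s x : Edge n) = boundaryCell n (2 * (x - 1).val + s + (s + ε) % 2) := by
  rw [endAt, cell_boundaryEdge]
  congr 1
  simp only
  omega

theorem cell_one_endAt (x : ZMod (2 * n)) : cell 1 (endAt 1 x) = cell 1 (endAt 0 x) := by
  simp [cell_endAt]

theorem cell_zero_endAt (x : ZMod (2 * n)) : cell 0 (endAt 1 x) = cell 0 (endAt 0 (x + 1)) := by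
  have hx := val_add_one_cases (x - 1)
  rw [sub_add_cancel] at hx
  rw [cell_endAt, cell_endAt, add_sub_cancel_right]
  rcases hx with ⟨-, hx⟩ | ⟨hlast, hx⟩
  · rw [hx]
    rfl
  · rw [hx]
    refine Eq.trans (congrArg _ ?_) (boundaryCell_four_mul n)
    simp only [Fin.val_one]
    omega

theorem blackConnected_gyrate_endAt_iff {ε : ℕ} (hφ : φ ∈ FplAt n s)
    (f : ZMod (2 * n) → ZMod (2 * n))
    (hf : ∀ x, cell ε (endAt (s + 1) (f x)) = cell ε (endAt s x)) (x y : ZMod (2 * n)) :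
    BlackConnected (gyrate ε φ) (endAt (s + 1) (f x)) (endAt (s + 1) (f y)) ↔
      BlackConnected φ (endAt s x) (endAt s y) := by
  have hψ := gyrate_mem hφ ε
  have hstrand : ∀ x, strand ε φ (endAt (s + 1) (f x)) = strand ε φ (endAt s x) := fun x => by
    rw [endAt, strand_boundaryEdge, endAt, strand_boundaryEdge]
    exact congrArg _ (hf x)
  constructor <;> intro h
  · have := h.gyrate (ε := ε) (e' := endAt s x) (f' := endAt s y) hψ
    simp only [gyrate_gyrate, strand_gyrate] at this
    exact this (endAt_black hφ x) (endAt_black hφ y) (hstrand x).symm (hstrand y).symm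
  · exact h.gyrate hφ (endAt_black hψ _) (endAt_black hψ _) (hstrand x) (hstrand y)

/-- `π(φ) = π` for `φ` in `FplAt n s`; for `s = 0` this is `HasLinkPattern φ π`. -/
def LinkedBy (s : Fin 2) (φ : Edge n → Colour) (π : LinkPattern n) : Prop :=
  ∀ x y : ZMod (2 * n), π.partner x = y ↔ x ≠ y ∧ BlackConnected φ (endAt s x) (endAt s y)

theorem LinkedBy.unique {π π' : LinkPattern n} (h : LinkedBy s φ π) (h' : LinkedBy s φ π') :
    π = π' := by
  ext x
  exact ((h' x _).2 ((h x _).1 rfl)).symm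

theorem LinkedBy.gyrate_of_cell_eq {ε : ℕ} {π π' : LinkPattern n} (h : LinkedBy s φ π)
    (hφ : φ ∈ FplAt n s) (f : Equiv.Perm (ZMod (2 * n)))
    (hf : ∀ x, cell ε (endAt (s + 1) (f x)) = cell ε (endAt s x))
    (hπ' : ∀ x, π'.partner (f x) = f (π.partner x)) : LinkedBy (s + 1) (gyrate ε φ) π' := by
  intro x y
  obtain ⟨x, rfl⟩ := f.surjective x
  obtain ⟨y, rfl⟩ := f.surjective y
  rw [blackConnected_gyrate_endAt_iff hφ f hf, hπ', f.apply_eq_iff_eq, h x y, f.injective.ne_iff]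

theorem LinkedBy.gyrate_one {π : LinkPattern n} (h : LinkedBy s φ π) (hφ : φ ∈ FplAt n s) :
    LinkedBy (s + 1) (gyrate 1 φ) π := by
  refine h.gyrate_of_cell_eq hφ (Equiv.refl _) (fun x => ?_) fun x => rfl
  fin_cases s
  exacts [cell_one_endAt x, (cell_one_endAt x).symm]

theorem LinkedBy.gyrate_zero {π : LinkPattern n} (h : LinkedBy 0 φ π) (hφ : φ ∈ FplAt n 0) :
    LinkedBy 1 (gyrate 0 φ) (R π) := by
  refine h.gyrate_of_cell_eq hφ (Equiv.subRight 1) (fun x => ?_) fun x => by simp [R, rotate]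
  have := cell_zero_endAt (x - 1)
  rwa [sub_add_cancel] at this

theorem LinkedBy.gyrate_zero_symm {π : LinkPattern n} (h : LinkedBy 1 φ π)
    (hφ : φ ∈ FplAt n 1) : LinkedBy 0 (gyrate 0 φ) (R.symm π) :=
  h.gyrate_of_cell_eq hφ (Equiv.addRight 1) (fun x => (cell_zero_endAt x).symm)
    fun x => by simp [R, unrotate]

end LinkedBy

/-! ## The potential of an even set of edges -/

section Potential

variable {n ε : ℕ} {χ : Edge n → ZMod 2} {v : Vertex n} {e f : Edge n}

/-- The edges with `χ e = 1` meet each vertex evenly. -/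
def IsEven (χ : Edge n → ZMod 2) : Prop :=
  ∀ v : Vertex n, ∑ e ∈ star v, χ e = 0

/-- The parity of the number of edges with `χ e = 1` which are crossed on the way from the cell
`(0, 0)` to the cell `P`, first upwards and then to the right. For even `χ`, every other way gives
the same parity, see `IsEven.eq_add_potential`. -/
def potential (χ : Edge n → ZMod 2) (P : ℕ × ℕ) : ZMod 2 :=
  ∑ r : Fin n with r.val < P.1, χ (.inl (r, 0)) +
    ∑ c : Fin n with c.val < P.2, χ (.inr (Fin.ofNat (n + 1) P.1, c))

theorem sum_lt_succ {M : Type*} [AddCommMonoid M] {m : ℕ} (f : Fin m → M) (k : Fin m) :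
    ∑ i : Fin m with i.val < k.val + 1, f i = ∑ i : Fin m with i.val < k.val, f i + f k := by
  have hfilter : ({i | i.val < k.val + 1} : Finset (Fin m)) =
      Finset.cons k {i | i.val < k.val} (by simp) := by
    ext i
    simp [Fin.ext_iff]
    omega
  rw [hfilter, Finset.sum_cons, add_comm]

theorem potential_right (χ : Edge n → ZMod 2) (k : Fin (n + 1)) (c : Fin n) :
    potential χ (k, c + 1) = potential χ (k, c) + χ (.inr (k, c)) := by
  simp only [potential, sum_lt_succ, Fin.ofNat_val_eq_self, add_assoc]

theorem IsEven.potential_up (hχ : IsEven χ) (r : Fin n) (k : Fin (n + 1)) :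
    potential χ (r + 1, k) = potential χ (r, k) + χ (.inl (r, k)) := by
  induction k using Fin.induction with
  | zero =>
    simp only [potential, sum_lt_succ, Fin.val_zero, not_lt_zero, Finset.filter_false,
      Finset.sum_empty, add_zero]
  | succ c ih =>
    have hbottom := potential_right χ r.castSucc c
    have htop := potential_right χ r.succ c
    have hsum : χ (.inl (r, c.castSucc)) + (χ (.inl (r, c.succ)) +
        (χ (.inr (r.castSucc, c)) + χ (.inr (r.succ, c)))) = 0 := by
      simpa [star, leftEdge, rightEdge, bottomEdge, topEdge, Fin.ext_iff] using hχ (r, c)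
    simp only [Fin.val_castSucc, Fin.val_succ] at hbottom htop ih ⊢
    rw [htop, hbottom, ih]
    grind

theorem IsEven.eq_add_potential (hχ : IsEven χ) (e : Edge n) :
    χ e = potential χ (cell 0 e) + potential χ (cell 1 e) := by
  rcases e with ⟨r, k⟩ | ⟨k, c⟩
  · have hup := hχ.potential_up r k
    rcases Nat.mod_two_eq_zero_or_one (r.val + k) with h | h <;> grind [cell]
  · have hright := potential_right χ k c
    rcases Nat.mod_two_eq_zero_or_one (k.val + c) with h | h <;> grind [cell]

theorem IsEven.potential_boundaryCell_succ (hχ : IsEven χ) (k : Fin (4 * n)) :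
    potential χ (boundaryCell n (k + 1)) =
      potential χ (boundaryCell n k) + χ (boundaryEdge k) := by
  rw [hχ.eq_add_potential, cell_boundaryEdge, cell_boundaryEdge]
  rcases Nat.mod_two_eq_zero_or_one k.val with h | h <;> grind

theorem IsEven.sum_boundaryEdge_lt (hχ : IsEven χ) {m : ℕ} (hm : m ≤ 4 * n) :
    ∑ k : Fin (4 * n) with k.val < m, χ (boundaryEdge k) =
      potential χ (boundaryCell n m) + potential χ (boundaryCell n 0) := by
  induction m with
  | zero => simp [CharTwo.add_self_eq_zero]
  | succ m ih =>
    have hsucc := hχ.potential_boundaryCell_succ ⟨m, hm⟩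
    simp only at hsucc
    rw [hsucc, sum_lt_succ _ (⟨m, hm⟩ : Fin (4 * n)), ih (by omega), add_right_comm]

theorem IsEven.sum_boundaryEdge (hχ : IsEven χ) : ∑ k, χ (boundaryEdge k) = 0 := by
  have h := hχ.sum_boundaryEdge_lt le_rfl
  rw [boundaryCell_four_mul, CharTwo.add_self_eq_zero] at h
  rw [← h]
  simp

theorem exists_cell_eq_of_mem_star (ε : ℕ) (he : e ∈ star v) :
    ∃ i j : Fin 2, cell ε e = (v.1 + i.val, v.2 + j.val) := by
  obtain ⟨r, c⟩ := v
  simp only [star, leftEdge, rightEdge, bottomEdge, topEdge, Finset.mem_insert,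
    Finset.mem_singleton] at he
  rcases he with rfl | rfl | rfl | rfl
  · exact ⟨⟨(r + c + ε) % 2, by omega⟩, 0, by simp [cell]⟩
  · exact ⟨⟨(r + (c + 1) + ε) % 2, by omega⟩, 1, by simp [cell]⟩
  · exact ⟨0, ⟨(r + c + ε) % 2, by omega⟩, by simp [cell]⟩
  · exact ⟨1, ⟨(r + 1 + c + ε) % 2, by omega⟩, by simp [cell]⟩

theorem IsEven.potential_eq_of_star (hχ : IsEven χ) (hv : ∀ e ∈ star v, χ e = 0)
    (he : e ∈ star v) (hf : f ∈ star v) :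
    potential χ (cell ε e) = potential χ (cell ε f) := by
  obtain ⟨r, c⟩ := v
  have hleft : potential χ (r + 1, c) = potential χ (r, c) := by
    have := hχ.potential_up r c.castSucc
    rwa [show χ (.inl (r, c.castSucc)) = 0 from hv (leftEdge (r, c)) (by simp [star]),
      add_zero] at this
  have hright : potential χ (r + 1, c + 1) = potential χ (r, c + 1) := by
    have := hχ.potential_up r c.succ
    rwa [show χ (.inl (r, c.succ)) = 0 from hv (rightEdge (r, c)) (by simp [star]),
      add_zero] at this
  have hbottom : potential χ (r, c + 1) = potential χ (r, c) := by
    have := potential_right χ r.castSucc c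
    rwa [show χ (.inr (r.castSucc, c)) = 0 from hv (bottomEdge (r, c)) (by simp [star]),
      add_zero] at this
  have hcell : ∀ g ∈ star (r, c), potential χ (cell ε g) = potential χ (r, c) := by
    intro g hg
    obtain ⟨i, j, hij⟩ := exists_cell_eq_of_mem_star ε hg
    fin_cases i <;> fin_cases j <;> simp [hij, hleft, hright, hbottom]
  rw [hcell e he, hcell f hf]

end Potential

/-! ## The two ends of a black path -/

section Paths

variable {n ε : ℕ} {s : Fin 2} {φ : Edge n → Colour} {v : Vertex n} {e f g : Edge n}

open Classical in
/-- The indicator function, modulo 2, of the black path or cycle through `e`. -/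
noncomputable def pathIndicator (φ : Edge n → Colour) (e f : Edge n) : ZMod 2 :=
  if BlackConnected φ e f then 1 else 0

theorem pathIndicator_eq_zero : pathIndicator φ e f = 0 ↔ ¬ BlackConnected φ e f := by
  simp [pathIndicator]

theorem isEven_pathIndicator (hφ : IceRule φ) (he : φ e = .b) : IsEven (pathIndicator φ e) := by
  intro v
  obtain ⟨a, b, hab, hfilter⟩ := Finset.card_eq_two.1 (hφ v).1
  have hmem : ∀ f, f ∈ star v ∧ φ f = .b ↔ f = a ∨ f = b := fun f => by
    rw [← Finset.mem_filter (p := fun f => φ f = .b), hfilter, Finset.mem_insert,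
      Finset.mem_singleton]
  obtain ⟨hav, ha⟩ := (hmem a).2 (.inl rfl)
  obtain ⟨hbv, hb⟩ := (hmem b).2 (.inr rfl)
  have hsum : ∑ f ∈ star v, pathIndicator φ e f = pathIndicator φ e a + pathIndicator φ e b := by
    rw [← Finset.sum_pair hab, ← hfilter, Finset.sum_filter_of_ne]
    intro f _ hf
    exact (not_not.1 (mt pathIndicator_eq_zero.2 hf)).black he
  have hiff : BlackConnected φ e a ↔ BlackConnected φ e b :=
    ⟨fun h => h.trans (BlackConnected.of_mem_star ha hb hav hbv),
      fun h => h.trans (BlackConnected.of_mem_star hb ha hbv hav)⟩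
  rw [hsum, pathIndicator, pathIndicator, hiff, CharTwo.add_self_eq_zero]

theorem potential_pathIndicator_eq (hφ : IceRule φ) (he : φ e = .b)
    (hf : ¬ BlackConnected φ e f) (h : BlackConnected φ f g) :
    potential (pathIndicator φ e) (cell ε f) = potential (pathIndicator φ e) (cell ε g) := by
  induction h with
  | refl => rfl
  | tail hfg hgk ih =>
    obtain ⟨hg, -, v, hgv, hkv⟩ := hgk
    refine ih.trans ((isEven_pathIndicator hφ he).potential_eq_of_star (fun a hav => ?_) hgv hkv)
    rw [pathIndicator_eq_zero]
    intro ha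
    have hag : BlackConnected φ a _ := .of_mem_star (ha.black he) hg hav hgv
    exact hf ((ha.trans hag).trans (BlackConnected.symm hfg))

theorem card_le_two_of_degree_le {V : Type*} [Fintype V] {G : SimpleGraph V}
    [DecidableRel G.Adj] (hG : G.Connected) (hdeg : ∀ a, G.degree a ≤ 2) (S : Finset V)
    (hS : ∀ a ∈ S, G.degree a ≤ 1) : S.card ≤ 2 := by
  classical
  have hedges := hG.card_vert_le_card_edgeSet_add_one
  have hsum : ∑ a, (G.degree a + if a ∈ S then 1 else 0) ≤ ∑ _a : V, 2 :=
    Finset.sum_le_sum fun a _ => by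
      have := hdeg a
      have := hS a
      split_ifs <;> grind
  rw [Finset.sum_add_distrib, G.sum_degrees_eq_twice_card_edges] at hsum
  simp only [Finset.sum_ite_mem, Finset.univ_inter, Finset.sum_const, smul_eq_mul, mul_one,
    Finset.card_univ] at hsum
  rw [Nat.card_eq_fintype_card, Nat.card_eq_fintype_card, ← SimpleGraph.edgeFinset_card] at hedges
  omega

theorem card_mem_star_le_two (e : Edge n) : ({v | e ∈ star v} : Finset (Vertex n)).card ≤ 2 := by
  by_contra! hlt
  obtain ⟨a, ha, b, hb, c, hc, hab, hac, hbc⟩ := Finset.two_lt_card.1 hlt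
  rcases e with ⟨r, k⟩ | ⟨k, c⟩ <;>
    simp only [Finset.mem_filter, Finset.mem_univ, true_and, mem_star_inl, mem_star_inr, ne_eq,
      Prod.ext_iff, Fin.ext_iff] at ha hb hc hab hac hbc <;>
    omega

theorem card_mem_star_boundaryEdge_le_one (k : Fin (4 * n)) :
    ({v | boundaryEdge k ∈ star v} : Finset (Vertex n)).card ≤ 1 := by
  refine Finset.card_le_one.2 fun a ha b hb => ?_
  unfold boundaryEdge at ha hb
  split_ifs at ha hb <;>
    simp only [Finset.mem_filter, Finset.mem_univ, true_and, mem_star_inl, mem_star_inr,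
      Fin.val_zero, Fin.val_last, Prod.ext_iff, Fin.ext_iff] at ha hb ⊢ <;> omega

/-- The graph of consecutive edges on the black path or cycle through `e`. -/
def pathGraph (φ : Edge n → Colour) (e : Edge n) : SimpleGraph {f // BlackConnected φ e f} :=
  .fromRel fun a b => BlackStep φ a b

theorem connected_pathGraph (φ : Edge n → Colour) (e : Edge n) : (pathGraph φ e).Connected := by
  have hreach : ∀ f (h : BlackConnected φ e f), (pathGraph φ e).Reachable ⟨e, .refl⟩ ⟨f, h⟩ := by
    intro f h
    induction h with
    | refl => exact .refl _
    | @tail f g hf hg ih =>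
      rcases eq_or_ne f g with rfl | hfg
      · exact ih
      · exact ih.trans (SimpleGraph.Adj.reachable ⟨fun h => hfg (Subtype.ext_iff.1 h), .inl hg⟩)
  have : Nonempty {f // BlackConnected φ e f} := ⟨⟨e, .refl⟩⟩
  exact ⟨fun a b => (hreach a a.2).symm.trans (hreach b b.2)⟩

theorem IceRule.eq_of_black (hφ : IceRule φ) (he : φ e = .b) (hf : φ f = .b) (hg : φ g = .b)
    (hev : e ∈ star v) (hfv : f ∈ star v) (hgv : g ∈ star v) (hfe : f ≠ e) (hge : g ≠ e) :
    f = g := by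
  have hcard : (((star v).filter fun e => φ e = .b).erase e).card ≤ 1 := by
    rw [Finset.card_erase_of_mem (by simp [*]), (hφ v).1]
  exact Finset.card_le_one.1 hcard f (by simp [*]) g (by simp [*])

open Classical in
theorem degree_pathGraph_le (hφ : IceRule φ) (he : φ e = .b) (a : {f // BlackConnected φ e f}) :
    (pathGraph φ e).degree a ≤ ({v | a.1 ∈ star v} : Finset (Vertex n)).card := by
  have hv : ∀ b, (pathGraph φ e).Adj a b → ∃ v : Vertex n, a.1 ∈ star v ∧ b.1 ∈ star v := by
    rintro b ⟨-, ⟨-, -, v, hav, hbv⟩ | ⟨-, -, v, hbv, hav⟩⟩ <;> exact ⟨v, hav, hbv⟩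
  have : Nonempty (Vertex n) := by
    rcases a with ⟨⟨r, _⟩ | ⟨_, r⟩, _⟩ <;> exact ⟨(r, r)⟩
  choose! w hw using hv
  rw [← SimpleGraph.card_neighborFinset_eq_degree]
  refine Finset.card_le_card_of_injOn w (fun b hb => ?_) fun b hb c hc hbc => ?_
  · simpa using (hw b (by simpa using hb)).1
  · rw [Finset.mem_coe, SimpleGraph.mem_neighborFinset] at hb hc
    exact Subtype.ext (hφ.eq_of_black (a.2.black he) (b.2.black he) (c.2.black he) (hw b hb).1
      (hw b hb).2 (hbc ▸ (hw c hc).2) (fun h => hb.ne (Subtype.ext h.symm))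
      fun h => hc.ne (Subtype.ext h.symm))

open Classical in
theorem card_ends_le_two (hφ : IceRule φ) (he : φ e = .b) :
    ({k | BlackConnected φ e (boundaryEdge k)} : Finset (Fin (4 * n))).card ≤ 2 := by
  let toEdge : {k : Fin (4 * n) // BlackConnected φ e (boundaryEdge k)} ↪
      {f // BlackConnected φ e f} :=
    ⟨fun k => ⟨boundaryEdge k, k.2⟩, fun k l h =>
      Subtype.ext (boundaryEdge_injective (Subtype.ext_iff.1 h))⟩
  have hle := card_le_two_of_degree_le (connected_pathGraph φ e)
    (fun a => (degree_pathGraph_le hφ he a).trans (card_mem_star_le_two a.1))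
    (Finset.univ.map toEdge) fun a ha => ?_
  · rwa [Finset.card_map, Finset.card_univ, Fintype.card_subtype] at hle
  · obtain ⟨k, -, rfl⟩ := Finset.mem_map.1 ha
    exact (degree_pathGraph_le hφ he _).trans (card_mem_star_boundaryEdge_le_one k.1)

theorem exists_other_end (hφ : IceRule φ) {k : Fin (4 * n)} (hk : φ (boundaryEdge k) = .b) :
    ∃ l, l ≠ k ∧ ∀ m, BlackConnected φ (boundaryEdge k) (boundaryEdge m) ↔ m = k ∨ m = l := by
  classical
  set ends := Finset.univ.filter fun m => BlackConnected φ (boundaryEdge k) (boundaryEdge m)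
    with hends
  have hmem : ∀ m, BlackConnected φ (boundaryEdge k) (boundaryEdge m) ↔ m ∈ ends := by
    simp [hends]
  have hkmem : k ∈ ends := (hmem k).1 .refl
  have heven : (ends.card : ZMod 2) = 0 := by
    rw [← (isEven_pathIndicator hφ hk).sum_boundaryEdge]
    simp [pathIndicator, hends]
  have hcard : ends.card = 2 := by
    have hle : ends.card ≤ 2 := card_ends_le_two hφ hk
    have hpos := Finset.card_pos.2 ⟨k, hkmem⟩
    have := (ZMod.natCast_eq_zero_iff _ _).1 heven
    omega
  obtain ⟨a, b, hab, heq⟩ := Finset.card_eq_two.1 hcard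
  simp only [hmem, heq, Finset.mem_insert, Finset.mem_singleton] at hkmem ⊢
  rcases hkmem with rfl | rfl
  exacts [⟨b, hab.symm, fun m => Iff.rfl⟩, ⟨a, hab, fun m => or_comm⟩]

theorem sum_pathIndicator_boundaryEdge_lt {k l : Fin (4 * n)} (hlk : l ≠ k)
    (hl : ∀ m, BlackConnected φ (boundaryEdge k) (boundaryEdge m) ↔ m = k ∨ m = l) (m : ℕ) :
    ∑ i : Fin (4 * n) with i.val < m, pathIndicator φ (boundaryEdge k) (boundaryEdge i) =
      (if k < m then 1 else 0) + (if l < m then 1 else 0) := by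
  have hadd : ∀ i, pathIndicator φ (boundaryEdge k) (boundaryEdge i) =
      (if k = i then 1 else 0) + (if l = i then 1 else 0) := by
    intro i
    rw [pathIndicator, hl]
    grind
  simp [hadd, Finset.sum_add_distrib]

theorem not_crossing (hφ : IceRule φ) {k l a b : Fin (4 * n)} (hk : φ (boundaryEdge k) = .b)
    (hkl : BlackConnected φ (boundaryEdge k) (boundaryEdge l))
    (hab : BlackConnected φ (boundaryEdge a) (boundaryEdge b)) (hka : k < a) (hal : a < l) :
    ¬ l < b := by
  intro hlb
  obtain ⟨l', hlk, hl'⟩ := exists_other_end hφ hk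
  obtain rfl : l = l' := ((hl' l).1 hkl).resolve_left (by omega)
  have hχ := isEven_pathIndicator hφ hk
  have ha : ¬ BlackConnected φ (boundaryEdge k) (boundaryEdge a) := by rw [hl']; omega
  have hb : ¬ BlackConnected φ (boundaryEdge k) (boundaryEdge b) := by rw [hl']; omega
  have hcell : ∀ i : Fin (4 * n), ¬ BlackConnected φ (boundaryEdge k) (boundaryEdge i) →
      potential (pathIndicator φ (boundaryEdge k)) (cell 0 (boundaryEdge i)) =
        potential (pathIndicator φ (boundaryEdge k)) (boundaryCell n i) := by
    intro i hi
    have hsucc := hχ.potential_boundaryCell_succ i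
    rw [pathIndicator_eq_zero.2 hi, add_zero] at hsucc
    rw [cell_boundaryEdge]
    grind
  have hpot := (hcell a ha).symm.trans
    ((potential_pathIndicator_eq (ε := 0) hφ hk ha hab).trans (hcell b hb))
  have hsum : ∀ m ≤ 4 * n, _ := fun m hm =>
    (hχ.sum_boundaryEdge_lt hm).symm.trans (sum_pathIndicator_boundaryEdge_lt hlk hl' m)
  have hsum_a := hsum a a.2.le
  rw [hpot, hsum b b.2.le] at hsum_a
  simp [hka, hal.not_gt, hlb, (hka.trans hal).trans hlb] at hsum_a

end Paths

section LinkPattern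

variable {n : ℕ} [NeZero n] {s : Fin 2} {φ : Edge n → Colour}

theorem exists_other_endAt (hφ : φ ∈ FplAt n s) (x : ZMod (2 * n)) :
    ∃ w ≠ x, ∀ y, BlackConnected φ (endAt s x) (endAt s y) ↔ y = x ∨ y = w := by
  obtain ⟨l, hl, hiff⟩ := exists_other_end hφ.1 (endAt_black hφ x)
  have hlb : φ (boundaryEdge l) = .b := ((hiff l).2 (.inr rfl)).black (endAt_black hφ x)
  obtain ⟨w, hw⟩ := exists_endAt_eq hφ hlb
  refine ⟨w, fun h => hl (boundaryEdge_injective (hw.symm.trans (congrArg _ h))), fun y => ?_⟩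
  rw [← (endAt_injective s).eq_iff, ← (endAt_injective s).eq_iff (a := y) (b := w), hw, endAt,
    endAt, boundaryEdge_injective.eq_iff, boundaryEdge_injective.eq_iff]
  exact hiff _

theorem not_crossing_endAt (hφ : φ ∈ FplAt n s) {x y x' y' : ZMod (2 * n)}
    (hx : BlackConnected φ (endAt s x) (endAt s x'))
    (hy : BlackConnected φ (endAt s y) (endAt s y')) (hxy : (x - 1).val < (y - 1).val)
    (hyx : (y - 1).val < (x' - 1).val) : ¬ (x' - 1).val < (y' - 1).val := by
  have := not_crossing hφ.1 (endAt_black hφ x) hx hy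
  simp only [Fin.lt_def] at this
  omega

/-- Labels and boundary edges are read off from different starting points, so the label `0`
moves from the first to the last place. -/
theorem exists_linkedBy (hφ : φ ∈ FplAt n s) : ∃ π : LinkPattern n, LinkedBy s φ π := by
  choose p hpx hp using exists_other_endAt hφ
  have hlink : ∀ x, BlackConnected φ (endAt s x) (endAt s (p x)) := fun x => (hp x _).2 (.inr rfl)
  refine ⟨⟨p, fun x => ?_, hpx, fun x y hxy hyx hcr => ?_⟩, fun x y => ?_⟩
  · exact (((hp (p x) x).1 (BlackConnected.symm (hlink x))).resolve_left (hpx x).symm).symm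
  · have h := not_crossing_endAt hφ (hlink x) (hlink y)
    have h₀ := not_crossing_endAt hφ (hlink y) (BlackConnected.symm (hlink x))
    have a₁ := val_add_one_cases (x - 1)
    have a₂ := val_add_one_cases (y - 1)
    have a₃ := val_add_one_cases (p x - 1)
    have a₄ := val_add_one_cases (p y - 1)
    simp only [sub_add_cancel] at a₁ a₂ a₃ a₄
    omega
  · rw [hp]
    grind

end LinkPattern

/-! ## Recognizing the Temperley-Lieb action -/

section TemperleyLieb

variable {n : ℕ} [NeZero n] {π π' : LinkPattern n} {y : ZMod (2 * n)}

theorem LinkPattern.ext_of_ne {a b : ZMod (2 * n)}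
    (h : ∀ x, x ≠ a → x ≠ b → π.partner x = π'.partner x) : π = π' := by
  ext x
  by_contra hne
  have hx : x = a ∨ x = b := by
    by_contra! hx
    exact hne (h x hx.1 hx.2)
  have hπ : π.partner x = a ∨ π.partner x = b := by
    by_contra! hπ
    have := h (π.partner x) hπ.1 hπ.2
    rw [π.partner_partner] at this
    exact hne (by rw [this, π'.partner_partner, ← this])
  have hπ' : π'.partner x = a ∨ π'.partner x = b := by
    by_contra! hπ'
    have := h (π'.partner x) hπ'.1 hπ'.2
    rw [π'.partner_partner] at this
    exact hne (by rw [← this, π.partner_partner, this])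
  have := π.partner_ne x
  have := π'.partner_ne x
  grind

theorem e_partner_self (y : ZMod (2 * n)) (π : LinkPattern n) :
    (e y π).partner y = y + 1 := by
  change arcPartner y π.partner y = y + 1
  grind [arcPartner]

theorem e_partner_of_ne {x : ZMod (2 * n)} (hy : x ≠ y) (hy' : x ≠ y + 1)
    (hpy : π.partner x ≠ y) (hpy' : π.partner x ≠ y + 1) :
    (e y π).partner x = π.partner x := by
  have := π.partner_partner
  change arcPartner y π.partner x = π.partner x
  grind [arcPartner]

theorem e_eq_of_partner (hy : π'.partner y = y + 1)
    (h : ∀ x, x ≠ y → x ≠ y + 1 → π.partner x ≠ y → π.partner x ≠ y + 1 →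
      π'.partner x = π.partner x) : e y π = π' := by
  have h₁ := π.partner_partner
  have h₂ := (e y π).partner_partner y
  have h₃ := π'.partner_partner y
  have h₄ := e_partner_self y π
  refine LinkPattern.ext_of_ne (a := π.partner y) (b := π.partner (y + 1)) fun x hx hx' => ?_
  by_cases hxy : x = y ∨ x = y + 1
  · grind
  · rw [e_partner_of_ne, h] <;> grind

theorem e_e (y : ZMod (2 * n)) (π : LinkPattern n) : e y (e y π) = e y π :=
  e_eq_of_partner (e_partner_self y π) fun _ _ _ _ _ => rfl

theorem e_R (y : ZMod (2 * n)) (π : LinkPattern n) : e (y - 1) (R π) = R (e y π) := by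
  refine e_eq_of_partner ?_ fun x hx hx' hpx hpx' => ?_
  · change (e y π).partner (y - 1 + 1) - 1 = y - 1 + 1
    rw [sub_add_cancel, e_partner_self, add_sub_cancel_right]
  · change (e y π).partner (x + 1) - 1 = π.partner (x + 1) - 1
    change π.partner (x + 1) - 1 ≠ _ at hpx hpx'
    rw [e_partner_of_ne] <;> grind

theorem e_R_symm (y : ZMod (2 * n)) (π : LinkPattern n) :
    e (y + 1) (R.symm π) = R.symm (e y π) := by
  rw [Equiv.eq_symm_apply, ← e_R, add_sub_cancel_right, Equiv.apply_symm_apply]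

end TemperleyLieb

/-! ## Exchanging the colours of a cell next to the boundary -/

section Swap

variable {n ε : ℕ} {s : Fin 2} {φ ψ : Edge n → Colour} {v w : Vertex n}
  {b l r f g p p' q q' : Edge n}

theorem BlackConnected.congr (h : BlackConnected φ f g)
    (hψ : ∀ x, BlackConnected φ f x → ψ x = .b) : BlackConnected ψ f g := by
  induction h with
  | refl => exact .refl
  | @tail x y hx hxy ih =>
    obtain ⟨-, -, v, hxv, hyv⟩ := id hxy
    exact ih.trans (BlackConnected.of_mem_star (hψ x hx) (hψ y (hx.tail hxy)) hxv hyv)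

theorem blackConnected_of_isStarSplit (hφ : φ ∈ FplAt n s) (h : IsStarSplit ε v p q p' q')
    (hpq : φ p ≠ φ q) (hp : φ p = .b) (hf : φ f = .b) (hfp' : cell ε f = cell ε p')
    (hP : ¬ Alternating ε φ (cell ε f)) : BlackConnected φ f p := by
  have hne : φ p' ≠ φ q' := ((hφ.1.colour h).resolve_right fun h => hpq h.1).2
  obtain hp' | hq' : φ p' = .b ∨ φ q' = .b := by
    cases hφp' : φ p' <;> cases hφq' : φ q' <;> simp_all
  · exact (blackConnected_of_cell_eq hφ hf hp' hfp'.symm hP).trans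
      (BlackConnected.of_mem_star hp' hp h.symm.left_mem h.left_mem)
  · exact (blackConnected_of_cell_eq hφ hf hq' (h.cell_eq'.trans hfp'.symm) hP).trans
      (BlackConnected.of_mem_star hq' hp h.symm.right_mem h.left_mem)

variable [NeZero n] {π π' : LinkPattern n} {y : ZMod (2 * n)}

theorem blackConnected_endAt (hφ : φ ∈ FplAt n s) (h : IsStarSplit ε v p q p' q')
    (hpq : φ p ≠ φ q) (hp : φ p = .b) (hy : cell ε (endAt s y) = cell ε p') :
    BlackConnected φ (endAt s y) p :=
  blackConnected_of_isStarSplit hφ h hpq hp (endAt_black hφ y) hy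
    (not_alternating_boundaryEdge ε φ _)

theorem partner_eq_add_one_of_black (hφ : φ ∈ FplAt n s) (hπ : LinkedBy s φ π)
    (hv : IsStarSplit ε v b l p p') (hw : IsStarSplit ε w b r q q')
    (hP : Alternating ε φ (cell ε b)) (hb : φ b = .b)
    (hy : cell ε (endAt s y) = cell ε p) (hy' : cell ε (endAt s (y + 1)) = cell ε q) :
    π.partner y = y + 1 := by
  have hval := val_add_one_cases y
  have hlt := one_lt_two_mul (n := n)
  refine (hπ y _).2 ⟨fun h => by rw [← h] at hval; omega, ?_⟩
  exact (blackConnected_endAt hφ hv (hP.ne hv) hb hy).trans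
    (BlackConnected.symm (blackConnected_endAt hφ hw (hP.ne hw) hb hy'))

theorem e_eq_of_white (hφ : φ ∈ FplAt n s) (hπ : LinkedBy s φ π)
    (hπ' : LinkedBy s (swapCell ε (cell ε b) φ) π') (hv : IsStarSplit ε v b l p p')
    (hw : IsStarSplit ε w b r q q') (hlr : l ≠ r) (hP : Alternating ε φ (cell ε b))
    (hb : φ b ≠ .b) (hy : cell ε (endAt s y) = cell ε p)
    (hy' : cell ε (endAt s (y + 1)) = cell ε q) : e y π = π' := by
  have hl : φ l = .b := by_contra fun hl => hP.ne hv (Colour.eq_of_ne_of_ne hb hl)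
  have hr : φ r = .b := by_contra fun hr => hP.ne hw (Colour.eq_of_ne_of_ne hb hr)
  have hyl := blackConnected_endAt hφ hv.swap (hP.ne hv).symm hl hy
  have hyr := blackConnected_endAt hφ hw.swap (hP.ne hw).symm hr hy'
  refine e_eq_of_partner ?_ fun x hxy hxy' hpy hpy' => ?_
  · exact partner_eq_add_one_of_black (swapCell_mem hφ ε _) hπ' hv hw
      (alternating_swapCell_iff.2 hP)
      ((swapCell_of_alternating hP rfl).trans (Colour.flip_eq_b.2 hb)) hy hy'
  · obtain ⟨hne, hx⟩ := (hπ x _).1 rfl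
    refine (hπ' x _).2 ⟨hne, hx.congr fun g hg => ?_⟩
    have hgb := hg.black (endAt_black hφ x)
    have hgl : g ≠ l := by
      rintro rfl
      exact hpy ((hπ x y).2 ⟨hxy, hg.trans (BlackConnected.symm hyl)⟩)
    have hgr : g ≠ r := by
      rintro rfl
      exact hpy' ((hπ x (y + 1)).2 ⟨hxy', hg.trans (BlackConnected.symm hyr)⟩)
    rw [swapCell_of_cell_ne, hgb]
    intro hgP
    have hlg : l.isLeft = g.isLeft := (hP.2 l g hv.cell_eq hgP).1 (hl.trans hgb.symm)
    have hl_r : l.isLeft = r.isLeft := (hP.2 l r hv.cell_eq hw.cell_eq).1 (hl.trans hr.symm)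
    exact (eq_or_eq_of_cell_eq (hw.cell_eq.trans hv.cell_eq.symm) (hgP.trans hv.cell_eq.symm)
      hl_r hlg hlr).elim hgl hgr

theorem e_eq_of_isStarSplit (hφ : φ ∈ FplAt n s) (hπ : LinkedBy s φ π)
    (hπ' : LinkedBy s (swapCell ε (cell ε b) φ) π') (hv : IsStarSplit ε v b l p p')
    (hw : IsStarSplit ε w b r q q') (hlr : l ≠ r) (hP : Alternating ε φ (cell ε b))
    (hy : cell ε (endAt s y) = cell ε p) (hy' : cell ε (endAt s (y + 1)) = cell ε q) :
    e y π = e y π' := by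
  by_cases hb : φ b = .b
  · have hψb : swapCell ε (cell ε b) φ b ≠ .b := by
      rw [swapCell_of_alternating hP rfl, Ne, Colour.flip_eq_b, not_not]
      exact hb
    have hπ₂ : LinkedBy s (swapCell ε (cell ε b) (swapCell ε (cell ε b) φ)) π := by
      rwa [swapCell_swapCell]
    rw [← e_eq_of_white (swapCell_mem hφ ε _) hπ' hπ₂ hv hw hlr (alternating_swapCell_iff.2 hP)
      hψb hy hy', e_e]
  · rw [← e_eq_of_white hφ hπ hπ' hv hw hlr hP hb hy hy', e_e]

/-- The corners of the cell `(1, k)` in the bottom row lie on the cells `(0, k - 1)` and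
`(0, k + 1)`, which carry the ends labelled `j` and `j + 1`. -/
theorem e_eq_of_linkedBy_swapCell {j k : ℕ} (hφ : φ ∈ FplAt n s) (hπ : LinkedBy s φ π)
    (hπ' : LinkedBy s (swapCell ε (1, k) φ) π') (hε : (ε + k) % 2 = 1)
    (hk : k = 2 * j ∨ s = 0 ∧ k + 1 = 2 * j) :
    e (j : ZMod (2 * n)) π = e (j : ZMod (2 * n)) π' := by
  by_cases hP : Alternating ε φ (1, k)
  swap
  · rw [swapCell_of_not_alternating hP] at hπ'
    rw [hπ.unique hπ']
  obtain ⟨-, hk₀, hkn⟩ := hP.1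
  have hval : ((j : ZMod (2 * n)) - 1).val = j - 1 := by
    obtain ⟨i, rfl⟩ : ∃ i, j = i + 1 := ⟨j - 1, by omega⟩
    rw [Nat.cast_succ, add_sub_cancel_right, ZMod.val_natCast_of_lt (by omega), Nat.add_sub_cancel]
  have hval' : ((j : ZMod (2 * n)) + 1 - 1).val = j := by
    rw [add_sub_cancel_right, ZMod.val_natCast_of_lt (by omega)]
  let v : Vertex n := (0, ⟨k - 1, by omega⟩)
  let w : Vertex n := (0, ⟨k, hkn⟩)
  have hvw : rightEdge v = leftEdge w := by
    simp [rightEdge, leftEdge, v, w, Nat.sub_add_cancel hk₀]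
  have hv : IsStarSplit ε v (rightEdge v) (topEdge v) (leftEdge v) (bottomEdge v) :=
    (isStarSplit_of_even (by simp [v]; omega)).symm
  have hw : IsStarSplit ε w (leftEdge w) (topEdge w) (rightEdge w) (bottomEdge w) :=
    isStarSplit_of_odd (by simp [w]; omega)
  have hb : cell ε (leftEdge w) = (1, k) := by simp [cell, leftEdge, w]; omega
  rw [hvw] at hv
  rw [← hb] at hπ' hP
  refine e_eq_of_isStarSplit hφ hπ hπ' hv hw ?_ hP ?_ ?_
  · simp [topEdge, v, w]; omega
  · rw [cell_endAt, hval]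
    simp only [cell, leftEdge, v, boundaryCell, Fin.val_zero, Fin.val_castSucc]
    grind
  · rw [cell_endAt, hval']
    simp only [cell, rightEdge, w, boundaryCell, Fin.val_zero, Fin.val_succ]
    grind

end Swap

/-! ## Vertex types and half gyrations -/

section GyrateAt

variable {n ε k : ℕ} {s : Fin 2} {φ ψ : Edge n → Colour} {f : Edge n} {v : Vertex n}
  {t : VertexType}

/-- Half gyration in which the cell `(1, k)` is treated as if it were not alternating. All edges at
its two bottom corners then change their colour, so that the types of these vertices are kept. -/
noncomputable def gyrateAt (ε k : ℕ) (φ : Edge n → Colour) : Edge n → Colour :=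
  gyrate ε (swapCell ε (1, k) φ)

theorem gyrate_injective (ε : ℕ) :
    Function.Injective (gyrate ε : (Edge n → Colour) → Edge n → Colour) :=
  (show Function.Involutive _ from gyrate_gyrate ε).injective

theorem gyrateAt_injective (ε k : ℕ) :
    Function.Injective (gyrateAt ε k : (Edge n → Colour) → Edge n → Colour) :=
  (gyrate_injective ε).comp (show Function.Involutive _ from swapCell_swapCell ε (1, k)).injective

theorem gyrateAt_mem (hφ : φ ∈ FplAt n s) (ε k : ℕ) : gyrateAt ε k φ ∈ FplAt n (s + 1) :=
  gyrate_mem (swapCell_mem hφ ε _) ε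

theorem gyrateAt_apply (hf : cell ε f = (1, k) ∨ (cell ε f).1 = 0) :
    gyrateAt ε k φ f = (φ f).flip := by
  rw [gyrateAt]
  rcases hf with hf | hf
  · by_cases hP : Alternating ε φ (1, k)
    · rw [gyrate_of_alternating (hf.symm ▸ alternating_swapCell_iff.2 hP),
        swapCell_of_alternating hP hf]
    · rw [swapCell_of_not_alternating hP, gyrate_of_not_alternating (hf.symm ▸ hP)]
  · rw [gyrate_of_not_alternating fun hP => hP.1.1.1.ne' hf, swapCell_of_cell_ne (by grind)]

theorem HasType.of_flip (h : HasType φ v t) (hψ : ∀ f ∈ star v, ψ f = (φ f).flip) :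
    HasType ψ v t := by
  have hl : ψ (leftEdge v) = _ := hψ _ (by simp [star])
  have hr : ψ (rightEdge v) = _ := hψ _ (by simp [star])
  have hb : ψ (bottomEdge v) = _ := hψ _ (by simp [star])
  have ht : ψ (topEdge v) = _ := hψ _ (by simp [star])
  cases t <;> simpa [HasType, hl, hr, hb, ht] using h

variable [NeZero n] {c : Fin n}

theorem HasType.gyrateAt (h : HasType φ (0, c) t) (hk : k = c ∨ k = c + 1)
    (hε : (ε + k) % 2 = 1) : HasType (gyrateAt ε k φ) (0, c) t := by
  refine h.of_flip fun f hf => gyrateAt_apply ?_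
  simp only [star, Finset.mem_insert, Finset.mem_singleton] at hf
  rcases hf with rfl | rfl | rfl | rfl <;>
    simp only [cell, leftEdge, rightEdge, bottomEdge, topEdge, Fin.val_zero, Fin.val_castSucc,
      Fin.val_succ, Prod.mk.injEq, true_and, or_true] <;> omega

theorem HasType.gyrate_a (h : HasType φ (0, c) .a) (hε : (ε + c) % 2 = 0) :
    HasType (gyrate ε φ) (0, c) .a := by
  have hcell : cell ε (rightEdge ((0, c) : Vertex n)) = (1, c.val + 1) := by
    simp [cell, rightEdge]; omega
  have hP : ¬ Alternating ε φ (1, c.val + 1) := fun hP =>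
    (hcell ▸ hP).ne (isStarSplit_of_even (by simp; omega)).symm h.2.1
  have := h.gyrateAt (ε := ε) (.inr rfl) (by omega)
  rwa [FPL.gyrateAt, swapCell_of_not_alternating hP] at this

theorem HasType.gyrate_b (h : HasType φ (0, c) .b) (hε : (ε + c) % 2 = 1) :
    HasType (gyrate ε φ) (0, c) .b := by
  have hcell : cell ε (leftEdge ((0, c) : Vertex n)) = (1, c.val) := by
    simp [cell, leftEdge]; omega
  have hP : ¬ Alternating ε φ (1, c.val) := fun hP =>
    (hcell ▸ hP).ne (isStarSplit_of_odd (by simp; omega)) h.1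
  have := h.gyrateAt (ε := ε) (.inl rfl) (by omega)
  rwa [FPL.gyrateAt, swapCell_of_not_alternating hP] at this

end GyrateAt

/-! ## Relations between the states -/

section States

variable {n : ℕ} [NeZero n] {c : Fin n} {t : VertexType}

/-- The set of colourings counted by the state of type `t` at the column `c`. -/
def typeSet (c : Fin n) (t : VertexType) : Set (Edge n → Colour) :=
  {φ | φ ∈ FplAt n 0 ∧ HasType φ (0, c) t}

/-- The link pattern of a colouring in `Fpl(n, +)`. -/
noncomputable def linkPattern (φ : typeSet c t) : LinkPattern n :=
  (exists_linkedBy φ.2.1).choose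

theorem linkedBy_linkPattern (φ : typeSet c t) : LinkedBy 0 φ.1 (linkPattern φ) :=
  (exists_linkedBy φ.2.1).choose_spec

open Classical in
theorem Psi_eq_card (c : Fin n) (t : VertexType) (π : LinkPattern n) :
    Psi c t π = {φ : typeSet c t | linkPattern φ = π}.toFinset.card := by
  rw [← Set.ncard_eq_toFinset_card', Psi, ← Set.ncard_image_of_injective _ Subtype.val_injective]
  congr 1
  ext φ
  constructor
  · rintro ⟨hφ, ht, hπ⟩
    rw [← fplAt_zero] at hφ
    exact ⟨⟨φ, hφ, ht⟩, (linkedBy_linkPattern ⟨φ, hφ, ht⟩).unique hπ, rfl⟩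
  · rintro ⟨φ, rfl, rfl⟩
    exact ⟨fplAt_zero n ▸ φ.2.1, φ.2.2, linkedBy_linkPattern φ⟩

open Classical in
theorem state_eq_sum (c : Fin n) (t : VertexType) :
    state c t = ∑ φ : typeSet c t, Finsupp.single (linkPattern φ) (1 : ℂ) := by
  rw [state, ← Finset.sum_fiberwise _ linkPattern]
  refine Finset.sum_congr rfl fun π _ => ?_
  rw [Finset.sum_congr rfl (g := fun _ => Finsupp.single π 1) (by simp +contextual),
    Finset.sum_const, ← Nat.cast_smul_eq_nsmul ℂ, Finsupp.smul_single, smul_eq_mul, mul_one,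
    Psi_eq_card, Set.toFinset_ofPred]

theorem lmapDomain_state_eq {f : (Edge n → Colour) → Edge n → Colour}
    (hf : Function.Injective f) (hmaps : ∀ φ ∈ typeSet c t, f φ ∈ typeSet c t)
    {g h : LinkPattern n → LinkPattern n}
    (hgh : ∀ φ ∈ typeSet c t, ∀ π π', LinkedBy 0 φ π → LinkedBy 0 (f φ) π' → g π = h π') :
    Finsupp.lmapDomain ℂ ℂ g (state c t) = Finsupp.lmapDomain ℂ ℂ h (state c t) := by
  classical
  let F : typeSet c t → typeSet c t := fun φ => ⟨f φ.1, hmaps φ.1 φ.2⟩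
  have hF : Function.Bijective F := Finite.injective_iff_bijective.1 fun φ ψ h =>
    Subtype.ext (hf (congrArg Subtype.val h))
  simp only [state_eq_sum, map_sum, Finsupp.lmapDomain_apply, Finsupp.mapDomain_single]
  rw [← hF.sum_comp fun φ => Finsupp.single (h (linkPattern φ)) (1 : ℂ)]
  exact Finset.sum_congr rfl fun φ _ => by
    rw [hgh φ.1 φ.2 _ _ (linkedBy_linkPattern φ) (linkedBy_linkPattern (F φ))]

theorem ROp_lmapDomain (g : LinkPattern n → LinkPattern n) (x : LPSpace n) :
    ROp (Finsupp.lmapDomain ℂ ℂ g x) = Finsupp.lmapDomain ℂ ℂ (R ∘ g) x := by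
  rw [ROp, Finsupp.domLCongr_apply, Finsupp.domCongr_apply, Finsupp.equivMapDomain_eq_mapDomain,
    Finsupp.lmapDomain_apply, Finsupp.lmapDomain_apply, ← Finsupp.mapDomain_comp]

theorem ROp_symm_lmapDomain (g : LinkPattern n → LinkPattern n) (x : LPSpace n) :
    ROp.symm (Finsupp.lmapDomain ℂ ℂ g x) = Finsupp.lmapDomain ℂ ℂ (R.symm ∘ g) x := by
  rw [LinearEquiv.symm_apply_eq, ROp_lmapDomain, ← Function.comp_assoc, Equiv.self_comp_symm,
    Function.id_comp]

theorem exists_linkedBy_gyrateAt_zero {φ : Edge n → Colour} {π : LinkPattern n} {j k : ℕ}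
    (hφ : φ ∈ FplAt n 0) (hπ : LinkedBy 0 φ π) (hk : k + 1 = 2 * j) :
    ∃ π', LinkedBy 1 (gyrateAt 0 k φ) (R π') ∧
      e (j : ZMod (2 * n)) π = e (j : ZMod (2 * n)) π' := by
  have hψ := swapCell_mem hφ 0 (1, k)
  obtain ⟨π', hπ'⟩ := exists_linkedBy hψ
  exact ⟨π', hπ'.gyrate_zero hψ,
    e_eq_of_linkedBy_swapCell hφ hπ hπ' (by omega) (.inr ⟨rfl, hk⟩)⟩

theorem exists_linkedBy_gyrateAt_one {s : Fin 2} {φ : Edge n → Colour} {π : LinkPattern n}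
    {j k : ℕ} (hφ : φ ∈ FplAt n s) (hπ : LinkedBy s φ π) (hk : k = 2 * j) :
    ∃ π', LinkedBy (s + 1) (gyrateAt 1 k φ) π' ∧
      e (j : ZMod (2 * n)) π = e (j : ZMod (2 * n)) π' := by
  have hψ := swapCell_mem hφ 1 (1, k)
  obtain ⟨π', hπ'⟩ := exists_linkedBy hψ
  exact ⟨π', hπ'.gyrate_one hψ, e_eq_of_linkedBy_swapCell hφ hπ hπ' (by omega) (.inl hk)⟩

theorem odd_relation {j : ℕ} (hj : 1 ≤ j) (hc : c.val = 2 * j - 2) (t : VertexType) :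
    eOp (j : ZMod (2 * n)) (state c t) =
      ROp.symm (eOp ((j : ZMod (2 * n)) - 1) (state c t)) := by
  refine (lmapDomain_state_eq ((gyrateAt_injective 1 c).comp (gyrateAt_injective 0 (c + 1)))
    (fun φ hφ => ⟨?_, ?_⟩) fun φ hφ π π' hπ hπ' => ?_).trans (ROp_symm_lmapDomain _ _).symm
  · exact gyrateAt_mem (gyrateAt_mem hφ.1 0 _) 1 _
  · exact (hφ.2.gyrateAt (.inr rfl) (by omega)).gyrateAt (.inl rfl) (by omega)
  · obtain ⟨π₁, h₁, he₁⟩ :=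
      exists_linkedBy_gyrateAt_zero (j := j) (k := c + 1) hφ.1 hπ (by omega)
    obtain ⟨π₂, h₂, he₂⟩ :=
      exists_linkedBy_gyrateAt_one (j := j - 1) (k := c) (gyrateAt_mem hφ.1 0 _) h₁ (by omega)
    obtain rfl := hπ'.unique h₂
    rw [Nat.cast_sub hj, Nat.cast_one] at he₂
    rw [he₁, Function.comp_apply, ← he₂, e_R, Equiv.symm_apply_apply]

theorem even_relation_a {j : ℕ} (hj : 1 ≤ j) (hc : c.val = 2 * j - 1) :
    eOp (j : ZMod (2 * n)) (state c .a) =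
      ROp.symm (eOp ((j : ZMod (2 * n)) - 1) (state c .a)) := by
  refine (lmapDomain_state_eq ((gyrate_injective 1).comp (gyrateAt_injective 0 c))
    (fun φ hφ => ⟨?_, ?_⟩) fun φ hφ π π' hπ hπ' => ?_).trans (ROp_symm_lmapDomain _ _).symm
  · exact gyrate_mem (gyrateAt_mem hφ.1 0 _) 1
  · exact (hφ.2.gyrateAt (.inl rfl) (by omega)).gyrate_a (by omega)
  · obtain ⟨π₁, h₁, he₁⟩ := exists_linkedBy_gyrateAt_zero (j := j) (k := c) hφ.1 hπ (by omega)
    obtain rfl := hπ'.unique (h₁.gyrate_one (gyrateAt_mem hφ.1 0 _))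
    rw [he₁, Function.comp_apply, e_R, Equiv.symm_apply_apply]

theorem even_relation_b {j : ℕ} (hj : 1 ≤ j) (hc : c.val = 2 * j - 1) :
    eOp (j : ZMod (2 * n)) (state c .b) =
      ROp (eOp ((j : ZMod (2 * n)) + 1) (state c .b)) := by
  refine (lmapDomain_state_eq ((gyrate_injective 0).comp (gyrateAt_injective 1 (c + 1)))
    (fun φ hφ => ⟨?_, ?_⟩) fun φ hφ π π' hπ hπ' => ?_).trans (ROp_lmapDomain _ _).symm
  · exact gyrate_mem (gyrateAt_mem hφ.1 1 _) 0
  · exact (hφ.2.gyrateAt (.inr rfl) (by omega)).gyrate_b (by omega)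
  · obtain ⟨π₁, h₁, he₁⟩ :=
      exists_linkedBy_gyrateAt_one (j := j) (k := c + 1) hφ.1 hπ (by omega)
    obtain rfl := hπ'.unique (h₁.gyrate_zero_symm (gyrateAt_mem hφ.1 1 _))
    rw [he₁, Function.comp_apply, e_R_symm, Equiv.apply_symm_apply]

end States

end FPL

theorem mainTheorem5 (n : ℕ) [NeZero n] :
    (∀ (j : ℕ) (h₁ : 1 ≤ j) (h₂ : j ≤ (n + 1) / 2),
      FPL.eOp (j : ZMod (2 * n)) (FPL.oddState .a j h₁ h₂) =
          FPL.ROp.symm (FPL.eOp ((j : ZMod (2 * n)) - 1) (FPL.oddState .a j h₁ h₂)) ∧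
      FPL.eOp (j : ZMod (2 * n)) (FPL.oddState .b j h₁ h₂) =
          FPL.ROp.symm (FPL.eOp ((j : ZMod (2 * n)) - 1) (FPL.oddState .b j h₁ h₂)) ∧
      FPL.eOp (j : ZMod (2 * n)) (FPL.oddState .c j h₁ h₂) =
          FPL.ROp.symm (FPL.eOp ((j : ZMod (2 * n)) - 1) (FPL.oddState .c j h₁ h₂))) ∧
    (∀ (j : ℕ) (h₁ : 1 ≤ j) (h₂ : j ≤ n / 2),
      FPL.eOp (j : ZMod (2 * n)) (FPL.evenState .a j h₁ h₂) =
          FPL.ROp.symm (FPL.eOp ((j : ZMod (2 * n)) - 1) (FPL.evenState .a j h₁ h₂)) ∧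
      FPL.eOp (j : ZMod (2 * n)) (FPL.evenState .b j h₁ h₂) =
          FPL.ROp (FPL.eOp ((j : ZMod (2 * n)) + 1) (FPL.evenState .b j h₁ h₂))) :=
  ⟨fun _ h₁ _ => ⟨FPL.odd_relation h₁ (Nat.sub_sub _ 1 1) .a,
    FPL.odd_relation h₁ (Nat.sub_sub _ 1 1) .b, FPL.odd_relation h₁ (Nat.sub_sub _ 1 1) .c⟩,
    fun _ h₁ _ => ⟨FPL.even_relation_a h₁ rfl, FPL.even_relation_b h₁ rfl⟩⟩
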